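/- **Theorem 7.5.** Let $M$ be a Garside monoid with Garside element $\Delta$: that is, $M$ is a cancellative monoid, generated by its atoms (elements $a\neq 1$ such that $a=yz$ implies $y=1$ or $z=1$), in which the lengths of the factorizations of any given element into atoms are bounded, in which any two elements have left and right greatest common divisors and least common multiples, and $\Delta\in M$ is an element whose left divisors coincide with its right divisors, these being finite in number and generating $M$. Let $G\supset M$ be the group of fractions of $M$, and let $\|\Delta\|$ be the maximal number of factors in a factorization of $\Delta$ into atoms. Write $x\prec y$ if $x^{-1}y\in M$, let $x\wedge y$ be the greatest lower bound of $x,y\in G$ with respect to $\prec$, put $x^u=u^{-1}xu$, and let $\tau(x)=\Delta^{-1}x\Delta$. An expression $\Delta^p x_1\cdots x_l$ ($p\in\mathbb Z$, $l\ge 0$), representing the element $x\in G$, is in *normal form* if every $x_i$ is a divisor of $\Delta$ in $M$ different from $1$ and $\Delta$, and $x\wedge\Delta^{p+i}=\Delta^p x_1\cdots x_i$ for $0\le i\le l$; every element of $G$ has a normal form. An element $x$ with normal form $\Delta^p x_1\cdots x_l$ is *rigid* if $l>0$ and $\Delta^p x_1\cdots x_l\,\tau^{-p}(x_1)$ is also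 in normal form. For $p,q\in\mathbb Z$ let $\mathbf{c}_{p,q}(x)=x^{\,x^p\wedge\Delta^q}$, let $$G_{p,q}=\{x\in G \mid \mathbf{c}_{p,q}^{\,N}(x)=x\text{ for some } N>0\},$$ and let $C^{*,*}(x)=C(x)\cap\bigcap_{p,q\in\mathbb Z}G_{p,q}$, where $C(x)$ is the conjugacy class of $x$ in $G$. Then: 1. If $x\in G$ is rigid, then $C^{*,*}(x)$ is precisely the set of rigid conjugates of $x$. 2. If $x\in G$ and some power $x^m$ ($m\in\mathbb Z$) is conjugate to a rigid element, then there is an integer $N$ with $0<N<\|\Delta\|^2$ such that $x^N$ is conjugate to a rigid element. -/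

import Mathlib

namespace Garside

section Monoid

variable {M : Type*} [Monoid M]

/-- Atoms: nontrivial elements without nontrivial factorization. -/
def IsAtomElt (x : M) : Prop := x ≠ 1 ∧ ∀ y z : M, x = y * z → y = 1 ∨ z = 1

/-- The set of lengths of the factorizations of `x` into atoms. -/
def atomLengths (x : M) : Set ℕ :=
  {n | ∃ l : List M, (∀ a ∈ l, IsAtomElt a) ∧ l.prod = x ∧ l.length = n}

/-- The norm `‖x‖`: the largest number of factors in a factorization of `x` into atoms. -/
noncomputable def atomNorm (x : M) : ℕ := sSup (atomLengths x)

/-- `M` is generated by its atoms, and the lengths of the factorizations of any given element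
into atoms are bounded. -/
structure IsAtomic (M : Type*) [Monoid M] : Prop where
  generated : Submonoid.closure {a : M | IsAtomElt a} = ⊤
  bounded : ∀ x : M, BddAbove (atomLengths x)

/-- `d` is a greatest common divisor of `x`, `y` for the divisibility relation `R`. -/
def IsGcdFor {α : Type*} (R : α → α → Prop) (x y d : α) : Prop :=
  R d x ∧ R d y ∧ ∀ e, R e x → R e y → R e d

/-- `m` is a least common multiple of `x`, `y` for the divisibility relation `R`. -/
def IsLcmFor {α : Type*} (R : α → α → Prop) (x y m : α) : Prop :=
  R x m ∧ R y m ∧ ∀ n, R x n → R y n → R m n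

/-- Gaussian monoids: cancellative, atomic, with left and right gcds and lcms. In a noncommutative
monoid `a ∣ b` is left divisibility, `b = a * c` for some `c`; `RightDvd a b` is `b = c * a`. -/
structure IsGaussian (M : Type*) [Monoid M] : Prop where
  cancel : IsCancelMul M
  atomic : IsAtomic M
  left_gcd : ∀ x y : M, ∃ d, IsGcdFor (fun a b : M => a ∣ b) x y d
  right_gcd : ∀ x y : M, ∃ d, IsGcdFor RightDvd x y d
  left_lcm : ∀ x y : M, ∃ m, IsLcmFor (fun a b : M => a ∣ b) x y m
  right_lcm : ∀ x y : M, ∃ m, IsLcmFor RightDvd x y m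

/-- `Δ` is a Garside element of `M`: its left and right divisors coincide, are finite in number
and generate `M`. -/
structure IsGarsideElement (Δ : M) : Prop where
  left_iff_right : ∀ s : M, s ∣ Δ ↔ RightDvd s Δ
  finite : {s : M | s ∣ Δ}.Finite
  generates : Submonoid.closure {s : M | s ∣ Δ} = ⊤

/-- `M` is a Garside monoid with Garside element `Δ`. -/
structure IsGarsideMonoid (Δ : M) : Prop where
  gaussian : IsGaussian M
  garside : IsGarsideElement Δ

end Monoid

section Group

variable {G : Type*} [Group G]

/-- `G` is the Garside group associated with the Garside monoid `M` (regarded as a submonoid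
of `G`) and the Garside element `Δ`: `G` is the group of fractions of `M`. -/
structure IsGarsideGroup (M : Submonoid G) (Δ : M) : Prop where
  garsideMonoid : IsGarsideMonoid Δ
  fractions : ∀ g : G, ∃ a b : M, g = (a : G) * (b : G)⁻¹

/-- The relation `x ≺ y` on `G`, i.e. `x⁻¹ y ∈ M`. -/
def Prec (M : Submonoid G) (x y : G) : Prop := x⁻¹ * y ∈ M

open Classical in
/-- The left greatest common divisor `x ∧ y` in `G`, i.e. the greatest lower bound of `x`, `y`
for `≺`. (In a Garside group it exists and is unique.) -/
noncomputable def meet (M : Submonoid G) (x y : G) : G :=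
  if h : ∃ d, IsGcdFor (Prec M) x y d then h.choose else 1

/-- The conjugation `x ^ u = u⁻¹ x u`. -/
def conjBy (x u : G) : G := u⁻¹ * x * u

/-- The cycling operation of order `(p, q)`: `x ↦ x ^ (x ^ p ∧ Δ ^ q)`. -/
noncomputable def cyc (M : Submonoid G) (Δ : M) (p q : ℤ) (x : G) : G :=
  conjBy x (meet M (x ^ p) ((Δ : G) ^ q))

/-- The recurrence set `G_{p,q}`: all `x` with `cyc_{p,q}^N (x) = x` for some `N > 0`. -/
def recurrenceSet (M : Submonoid G) (Δ : M) (p q : ℤ) : Set G :=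
  {x | ∃ N : ℕ, 0 < N ∧ (cyc M Δ p q)^[N] x = x}

/-- The conjugacy class `C(x)`. -/
def conjClass (x : G) : Set G := {y | IsConj x y}

/-- The summit set `C^{*,*}(x)`: the intersection of `C(x)` with all the sets `G_{p,q}`. -/
def stableSummitSet (M : Submonoid G) (Δ : M) (x : G) : Set G :=
  conjClass x ∩ ⋂ (p : ℤ) (q : ℤ), recurrenceSet M Δ p q

/-- The simple elements: the divisors of `Δ` in `M`. -/
def simples (M : Submonoid G) (Δ : M) : Set G := {s | s ∈ M ∧ Prec M s (Δ : G)}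

/-- The expression `Δ ^ p x₁ ⋯ x_l`, where `L = [x₁, …, x_l]`, is in (left) normal form:
`x_i ∈ S \ {1, Δ}` and `x ∧ Δ ^ (p + i) = Δ ^ p x₁ ⋯ x_i` for `0 ≤ i ≤ l`, where `x` is the
element represented by the expression. -/
def IsNormalForm (M : Submonoid G) (Δ : M) (p : ℤ) (L : List G) : Prop :=
  (∀ s ∈ L, s ∈ simples M Δ ∧ s ≠ 1 ∧ s ≠ (Δ : G)) ∧
  ∀ i : ℕ, i ≤ L.length →
    meet M ((Δ : G) ^ p * L.prod) ((Δ : G) ^ (p + (i : ℤ))) = (Δ : G) ^ p * (L.take i).prod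

/-- `x` is rigid: its normal form is `Δ ^ p x₁ ⋯ x_l` with `l > 0`, and
`Δ ^ p x₁ ⋯ x_l τ^{-p}(x₁)` is also in normal form, where `τ(y) = Δ⁻¹ y Δ`. -/
def IsRigid (M : Submonoid G) (Δ : M) (x : G) : Prop :=
  ∃ (p : ℤ) (x₁ : G) (L : List G),
    x = (Δ : G) ^ p * (x₁ :: L).prod ∧
    IsNormalForm M Δ p (x₁ :: L) ∧
    IsNormalForm M Δ p ((x₁ :: L) ++ [(Δ : G) ^ p * x₁ * (Δ : G) ^ (-p)])

end Group

end Garside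

/-! Rigidity is a lattice condition: `x` is rigid iff, for some p < q, Δ^p ≺ x ≺ Δ^q, x is neither
bound, and x² ∧ Δ^(p+q) = xΔ^p (`RigidBetween`, `isRigid_iff`). Iterating gives x^(a+b) ∧ Δ^(aq+bp)
= x^a Δ^(bp) (`prec_pow_mul_zpow`).

Part 1. For rigid x and pm ≤ k ≤ qm, applying c_{m,k} N times conjugates x by x^(mN) ∧ Δ^(kN). For a
suitable N this is a power of x times a central power of Δ, so x is recurrent (`mem_recurrenceSet`).
Conversely, let y = x^v with v in M be recurrent for (1,p), (1,q) and (2,p+q)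
(`rigidBetween_of_recurrent`). Each cycling carries v to a new conjugator in M whose norm changes
monotonically, and strictly unless y satisfies the corresponding meet identity. Periodicity forbids
a strict change, and the three identities say that y is rigid.

Part 2. Let y^m be rigid between Δ^p and Δ^q. Conjugators keeping y^m rigid are closed under ∧, so a
meet over an orbit yields a conjugate z for which Δ^(sn) ≺ y^(kn) improves to Δ^s ≺ z^k
(`exists_conjBy_zpow_prec`). This bounds the reduced denominators of p/m and q/m by the length of a
strict chain from 1 to Δ (`exists_dvd_mul_of_rigidBetween`). A common denominator N below ‖Δ‖² makes
Np/m and Nq/m integers p', q'. Some conjugate z then has Δ^p' ≺ z^N ≺ Δ^q' with z^m still rigid, and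
rigidity descends from (z^N)^m to z^N (`rigidBetween_of_pow`). -/

namespace Garside

/-! ### Left divisibility and conjugation in a group with a submonoid -/

section Order

variable {G : Type*} [Group G] {M : Submonoid G}

theorem prec_refl (x : G) : Prec M x x := by simp [Prec]

theorem Prec.trans {x y z : G} (h₁ : Prec M x y) (h₂ : Prec M y z) : Prec M x z := by
  have := M.mul_mem h₁ h₂
  simpa [Prec, mul_assoc] using this

theorem prec_mul_left_iff (a : G) {x y : G} : Prec M (a * x) (a * y) ↔ Prec M x y := by
  simp [Prec, mul_assoc]

theorem one_prec_iff {x : G} : Prec M 1 x ↔ x ∈ M := by simp [Prec]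

theorem prec_mul_right {x a : G} (h : a ∈ M) : Prec M x (x * a) := by
  simpa [Prec] using h

theorem inv_mul_prec_iff {a x y : G} : Prec M (a⁻¹ * x) y ↔ Prec M x (a * y) := by
  rw [← prec_mul_left_iff a]; simp

theorem prec_inv_mul_iff {a x y : G} : Prec M x (a⁻¹ * y) ↔ Prec M (a * x) y := by
  rw [← prec_mul_left_iff a]; simp

theorem conjBy_zpow (x u : G) (n : ℤ) : (conjBy x u) ^ n = conjBy (x ^ n) u := by
  have h := map_zpow (MulAut.conj u⁻¹) x n
  simpa [conjBy, MulAut.conj_apply] using h.symm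

theorem conjBy_pow (x u : G) (n : ℕ) : (conjBy x u) ^ n = conjBy (x ^ n) u := by
  simpa using conjBy_zpow x u n

theorem conjBy_inv (x u : G) : (conjBy x u)⁻¹ = conjBy x⁻¹ u := by
  simp [conjBy, mul_assoc]

theorem conjBy_conjBy (x u v : G) : conjBy (conjBy x u) v = conjBy x (u * v) := by
  simp [conjBy, mul_assoc]

theorem conjBy_one (x : G) : conjBy x 1 = x := by simp [conjBy]

theorem mul_conjBy (x u : G) : u * conjBy x u = x * u := by simp [conjBy, mul_assoc]

theorem conjBy_eq_self {x u : G} (h : Commute x u) : conjBy x u = x := by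
  rw [conjBy, mul_assoc, h.eq]; simp

theorem isConj_iff_exists_conjBy {x y : G} : IsConj x y ↔ ∃ u, y = conjBy x u := by
  rw [isConj_iff]
  constructor
  · rintro ⟨c, rfl⟩; exact ⟨c⁻¹, by simp [conjBy]⟩
  · rintro ⟨u, rfl⟩; exact ⟨u⁻¹, by simp [conjBy]⟩

end Order

section Atomic

variable {N : Type*} [Monoid N]

theorem IsAtomic.exists_atoms (h : IsAtomic N) (x : N) :
    ∃ l : List N, (∀ a ∈ l, IsAtomElt a) ∧ l.prod = x :=
  Submonoid.exists_list_of_mem_closure (s := {a : N | IsAtomElt a}) (by rw [h.generated]; trivial)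

/-- Otherwise repeating the atoms of a and b would factor 1 into arbitrarily many atoms. -/
theorem IsAtomic.eq_one_of_mul_eq_one (h : IsAtomic N) {a b : N} (hab : a * b = 1) : a = 1 := by
  by_contra ha
  obtain ⟨la, hla, rfl⟩ := h.exists_atoms a
  obtain ⟨lb, hlb, rfl⟩ := h.exists_atoms b
  obtain ⟨B, hB⟩ := h.bounded 1
  have hpos : 1 ≤ la.length := by
    rcases la with _ | ⟨x, l⟩
    · simp at ha
    · simp
  have hmem : (List.replicate (B + 1) (la ++ lb)).flatten.length ∈ atomLengths (1 : N) := by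
    refine ⟨_, ?_, ?_, rfl⟩
    · intro a ha
      simp only [List.mem_flatten, List.mem_replicate] at ha
      obtain ⟨l, ⟨-, rfl⟩, ha⟩ := ha
      rcases List.mem_append.1 ha with h | h
      exacts [hla a h, hlb a h]
    · rw [List.prod_flatten, List.map_replicate, List.prod_replicate, List.prod_append, hab,
        one_pow]
  have h2 := hB hmem
  simp only [List.length_flatten, List.map_replicate, List.sum_replicate, List.length_append,
    smul_eq_mul] at h2
  nlinarith

end Atomic

/-! ### The lattice order of a Garside group and its invariance under Δ -/

section Basic

variable {G : Type*} [Group G] {M : Submonoid G} {Δ : M}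

theorem coe_dvd_iff {a b : M} : a ∣ b ↔ Prec M (a : G) (b : G) := by
  constructor
  · rintro ⟨c, rfl⟩
    simp [Prec]
  · intro h
    exact ⟨⟨_, h⟩, by ext; simp⟩

theorem coe_zpow_mem {k : ℤ} (hk : 0 ≤ k) : (Δ : G) ^ k ∈ M := by
  lift k to ℕ using hk
  rw [zpow_natCast]; exact M.pow_mem Δ.2 k

theorem zpow_prec_zpow {i j : ℤ} (h : i ≤ j) : Prec M ((Δ : G) ^ i) ((Δ : G) ^ j) := by
  have := coe_zpow_mem (Δ := Δ) (k := j - i) (by omega)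
  rwa [Prec, ← zpow_neg, ← zpow_add, neg_add_eq_sub]

theorem mul_zpow_prec {i : ℤ} (h : i ≤ 0) (g : G) : Prec M (g * (Δ : G) ^ i) g := by
  have := (prec_mul_left_iff (M := M) g).2 (zpow_prec_zpow (Δ := Δ) h)
  simpa using this

namespace IsGarsideGroup

variable (hG : IsGarsideGroup M Δ)
include hG

theorem atomic : IsAtomic M := hG.garsideMonoid.gaussian.atomic

theorem eq_one_of_mem_inv_mem {a : G} (ha : a ∈ M) (ha' : a⁻¹ ∈ M) : a = 1 := by
  have := hG.atomic.eq_one_of_mul_eq_one (a := ⟨a, ha⟩) (b := ⟨a⁻¹, ha'⟩) (by ext; simp)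
  simpa using congrArg Subtype.val this

theorem antisymm {x y : G} (h₁ : Prec M x y) (h₂ : Prec M y x) : x = y := by
  have := hG.eq_one_of_mem_inv_mem (a := x⁻¹ * y) h₁ (by simpa [Prec] using h₂)
  exact inv_mul_eq_one.1 this

theorem mem_induction {p : G → Prop} (one : p 1) (mul : ∀ a b, p a → p b → p (a * b))
    (simple : ∀ s ∈ simples M Δ, p s) {a : G} (ha : a ∈ M) : p a := by
  have h : (⟨a, ha⟩ : M) ∈ Submonoid.closure {s : M | s ∣ Δ} := by
    rw [hG.garsideMonoid.garside.generates]; trivial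
  have key : ∀ x ∈ Submonoid.closure {s : M | s ∣ Δ}, p (x : G) := by
    intro x hx
    induction hx using Submonoid.closure_induction with
    | mem x hx => exact simple _ ⟨x.2, coe_dvd_iff.1 hx⟩
    | one => exact one
    | mul x y _ _ hx hy => exact mul _ _ hx hy
  exact key _ h

theorem right_dvd_of_simple {s : G} (hs : s ∈ simples M Δ) : ∃ t ∈ simples M Δ, (Δ : G) = t * s := by
  obtain ⟨c, hc⟩ := (hG.garsideMonoid.garside.left_iff_right ⟨s, hs.1⟩).1 (coe_dvd_iff.2 hs.2)
  exact ⟨c, ⟨c.2, coe_dvd_iff.1 ⟨_, hc⟩⟩, congrArg Subtype.val hc⟩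

theorem left_dvd_of_simple {s : G} (hs : s ∈ simples M Δ) : ∃ t ∈ simples M Δ, (Δ : G) = s * t := by
  obtain ⟨c, hc⟩ := (coe_dvd_iff (a := ⟨s, hs.1⟩)).2 hs.2
  exact ⟨c, ⟨c.2, coe_dvd_iff.1 ((hG.garsideMonoid.garside.left_iff_right c).2 ⟨_, hc⟩)⟩,
    congrArg Subtype.val hc⟩

/-- Taking complements twice, Δ = st = tr, gives sΔ = str = Δr, so τ(s) = r is again simple. -/
theorem conj_mem {a : G} (ha : a ∈ M) : (Δ : G)⁻¹ * a * Δ ∈ M := by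
  refine hG.mem_induction (p := fun a => (Δ : G)⁻¹ * a * Δ ∈ M) (by simp) ?_ ?_ ha
  · intro a b h₁ h₂
    simpa [mul_assoc] using M.mul_mem h₁ h₂
  · intro s hs
    obtain ⟨t, ht, h⟩ := hG.left_dvd_of_simple hs
    obtain ⟨r, hr, h'⟩ := hG.left_dvd_of_simple ht
    have : s * (Δ : G) = Δ * r := by
      calc s * (Δ : G) = s * (t * r) := by rw [← h']
        _ = Δ * r := by rw [← mul_assoc, ← h]
    rw [mul_assoc, this]
    simpa using hr.1

theorem conj_inv_mem {a : G} (ha : a ∈ M) : (Δ : G) * a * (Δ : G)⁻¹ ∈ M := by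
  refine hG.mem_induction (p := fun a => (Δ : G) * a * (Δ : G)⁻¹ ∈ M) (by simp) ?_ ?_ ha
  · intro a b h₁ h₂
    simpa [mul_assoc] using M.mul_mem h₁ h₂
  · intro s hs
    obtain ⟨t, ht, h⟩ := hG.right_dvd_of_simple hs
    obtain ⟨r, hr, h'⟩ := hG.right_dvd_of_simple ht
    have : (Δ : G) * s = r * Δ := by
      calc (Δ : G) * s = r * t * s := by rw [← h']
        _ = r * Δ := by rw [mul_assoc, ← h]
    rw [this]
    simpa using hr.1

theorem conjBy_zpow_mem (k : ℤ) {a : G} (ha : a ∈ M) : conjBy a ((Δ : G) ^ k) ∈ M := by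
  induction k with
  | zero => simpa [conjBy] using ha
  | succ n ih =>
    rw [zpow_add_one, ← conjBy_conjBy]
    exact hG.conj_mem ih
  | pred n ih =>
    rw [zpow_sub_one, ← conjBy_conjBy]
    simpa [conjBy] using hG.conj_inv_mem ih

theorem conjBy_zpow_mem_iff (k : ℤ) {a : G} : conjBy a ((Δ : G) ^ k) ∈ M ↔ a ∈ M := by
  refine ⟨fun h => ?_, hG.conjBy_zpow_mem k⟩
  have := hG.conjBy_zpow_mem (-k) h
  simpa [conjBy_conjBy, conjBy_one] using this

theorem prec_mul_zpow_iff (k : ℤ) {x y : G} :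
    Prec M (x * (Δ : G) ^ k) (y * (Δ : G) ^ k) ↔ Prec M x y := by
  rw [Prec, Prec, ← hG.conjBy_zpow_mem_iff k (a := x⁻¹ * y)]
  simp [conjBy, mul_assoc]

theorem mul_zpow_prec_iff (k : ℤ) {x y : G} :
    Prec M (x * (Δ : G) ^ k) y ↔ Prec M x (y * (Δ : G) ^ (-k)) := by
  rw [← hG.prec_mul_zpow_iff (-k)]; simp

theorem exists_prec_zpow_of_mem {a : G} (ha : a ∈ M) : ∃ r : ℕ, Prec M a ((Δ : G) ^ (r : ℤ)) := by
  refine hG.mem_induction (p := fun a => ∃ r : ℕ, Prec M a ((Δ : G) ^ (r : ℤ)))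
    ⟨0, by simpa using prec_refl _⟩ ?_ ?_ ha
  · rintro a b ⟨r, hr⟩ ⟨t, ht⟩
    refine ⟨r + t, ((prec_mul_left_iff a).2 ht).trans ?_⟩
    push_cast
    rw [zpow_add]
    exact (hG.prec_mul_zpow_iff _).2 hr
  · intro s hs
    exact ⟨1, by simpa using hs.2⟩

theorem exists_zpow_prec (g : G) : ∃ r : ℕ, Prec M ((Δ : G) ^ (-(r : ℤ))) g := by
  obtain ⟨a, b, rfl⟩ := hG.fractions g
  obtain ⟨r, hr⟩ := hG.exists_prec_zpow_of_mem b.2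
  refine ⟨r, ?_⟩
  have h1 : Prec M ((1 : G) * (Δ : G) ^ (-(r : ℤ))) ((b : G)⁻¹) := by
    rw [hG.mul_zpow_prec_iff, neg_neg, prec_inv_mul_iff, mul_one]; exact hr
  have h2 := (prec_mul_left_iff (a : G)).2 h1
  refine Prec.trans ?_ h2
  rw [one_mul]
  nth_rw 1 [← one_mul ((Δ : G) ^ (-(r : ℤ)))]
  rw [hG.prec_mul_zpow_iff, one_prec_iff]
  exact a.2

theorem exists_prec_zpow (g : G) : ∃ r : ℕ, Prec M g ((Δ : G) ^ (r : ℤ)) := by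
  obtain ⟨r, hr⟩ := hG.exists_zpow_prec g⁻¹
  refine ⟨r, ?_⟩
  have h := (prec_mul_left_iff g).2 hr
  rwa [mul_inv_cancel, hG.mul_zpow_prec_iff, neg_neg, one_mul] at h

/-- Some positive power of the Garside element is central. -/
theorem exists_central : ∃ e : ℕ, 0 < e ∧ ∀ g : G, Commute g ((Δ : G) ^ (e : ℤ)) := by
  have hfin : Finite {s : M | s ∣ Δ} := hG.garsideMonoid.garside.finite
  have hstab : ∀ (n : ℕ) (s : {s : M | s ∣ Δ}),
      conjBy ((s : M) : G) ((Δ : G) ^ (n : ℤ)) ∈ M := fun n s => hG.conjBy_zpow_mem _ s.1.2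
  have hdvd : ∀ (n : ℕ) (s : {s : M | s ∣ Δ}), (⟨_, hstab n s⟩ : M) ∣ Δ := by
    intro n s
    have h : Prec M ((s : M) : G) (Δ : G) := coe_dvd_iff.1 s.2
    rw [coe_dvd_iff, Prec]
    have := hG.conjBy_zpow_mem (n : ℤ) h
    change (conjBy ((s : M) : G) _)⁻¹ * _ ∈ M
    have hc : (Δ : G) * (Δ : G) ^ (n : ℤ) = (Δ : G) ^ (n : ℤ) * Δ := (Commute.self_zpow _ _).eq
    simp only [conjBy, mul_inv_rev, inv_inv, mul_assoc, hc] at this ⊢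
    exact this
  -- Conjugation by powers of Δ acts on the finite set of simples, so two distinct powers act alike;
  -- their quotient commutes with all simples, hence with G.
  let f : ℕ → {s : M | s ∣ Δ} → {s : M | s ∣ Δ} := fun n s => ⟨⟨_, hstab n s⟩, hdvd n s⟩
  obtain ⟨a, b, hne, hab⟩ := Finite.exists_ne_map_eq_of_infinite f
  wlog hlt : a < b generalizing a b
  · exact this b a hne.symm hab.symm (by omega)
  obtain ⟨c, rfl⟩ := Nat.exists_eq_add_of_lt hlt
  refine ⟨c + 1, by omega, ?_⟩
  have hsimple : ∀ s ∈ simples M Δ, Commute s ((Δ : G) ^ ((c + 1 : ℕ) : ℤ)) := by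
    intro s hs
    have h := congrFun hab ⟨⟨s, hs.1⟩, coe_dvd_iff.2 hs.2⟩
    have h : conjBy s ((Δ : G) ^ (a : ℤ)) = conjBy s ((Δ : G) ^ ((a + c + 1 : ℕ) : ℤ)) :=
      congrArg (fun t : {s : M | s ∣ Δ} => ((t : M) : G)) h
    have h := congrArg (fun t : G => conjBy t ((Δ : G) ^ (-(a : ℤ)))) h
    simp only [conjBy_conjBy, ← zpow_add, add_neg_cancel, zpow_zero, conjBy_one] at h
    have he : ((a + c + 1 : ℕ) : ℤ) + -(a : ℤ) = ((c + 1 : ℕ) : ℤ) := by push_cast; ring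
    rw [he] at h
    have h' := mul_conjBy s ((Δ : G) ^ ((c + 1 : ℕ) : ℤ))
    rw [← h] at h'
    exact h'.symm
  have hM : ∀ a ∈ M, Commute a ((Δ : G) ^ ((c + 1 : ℕ) : ℤ)) := fun a ha =>
    hG.mem_induction (p := fun x => Commute x _) (Commute.one_left _)
      (fun _ _ h₁ h₂ => h₁.mul_left h₂) hsimple ha
  intro g
  obtain ⟨x, y, rfl⟩ := hG.fractions g
  exact (hM x x.2).mul_left (hM y y.2).inv_left

theorem exists_simple_prec {a : G} (ha : a ∈ M) (h1 : a ≠ 1) :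
    ∃ s ∈ M, s ≠ 1 ∧ Prec M s (Δ : G) ∧ Prec M s a := by
  have : a ∈ M ∧ (a ≠ 1 → ∃ s ∈ M, s ≠ 1 ∧ Prec M s (Δ : G) ∧ Prec M s a) := by
    refine hG.mem_induction
      (p := fun a => a ∈ M ∧ (a ≠ 1 → ∃ s ∈ M, s ≠ 1 ∧ Prec M s (Δ : G) ∧ Prec M s a))
      ⟨M.one_mem, fun h => absurd rfl h⟩ ?_ ?_ ha
    · rintro a b ⟨ha, iha⟩ ⟨hb, ihb⟩
      refine ⟨M.mul_mem ha hb, fun h => ?_⟩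
      by_cases ha1 : a = 1
      · subst ha1
        rw [one_mul] at h ⊢
        exact ihb h
      · obtain ⟨s, hs, hs1, hsD, hsa⟩ := iha ha1
        exact ⟨s, hs, hs1, hsD, hsa.trans (prec_mul_right hb)⟩
    · intro s hs
      exact ⟨hs.1, fun h => ⟨s, hs.1, h, hs.2, prec_refl _⟩⟩
  exact this.2 h1

/-- An element all of whose lower bounds below `Δ ^ (p + 1)` are below `Δ ^ p` is `Δ ^ p`. -/
theorem eq_zpow_of_forall {p : ℤ} {d : G} (hd : Prec M ((Δ : G) ^ p) d)
    (h : ∀ g, Prec M g d → Prec M g ((Δ : G) ^ (p + 1)) → Prec M g ((Δ : G) ^ p)) :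
    d = (Δ : G) ^ p := by
  by_contra hne
  obtain ⟨s, hs, hs1, hsD, hsa⟩ := hG.exists_simple_prec hd
    (fun h => hne (inv_mul_eq_one.1 h).symm)
  have := h ((Δ : G) ^ p * s) (by rwa [prec_inv_mul_iff] at hsa)
    (by rw [zpow_add_one, prec_mul_left_iff]; exact hsD)
  refine hs1 (hG.eq_one_of_mem_inv_mem hs ?_)
  simpa [Prec] using this

theorem isGcdFor_meet (x y : G) : IsGcdFor (Prec M) x y (meet M x y) := by
  have hex : ∃ d, IsGcdFor (Prec M) x y d := by
    obtain ⟨r, hr⟩ := hG.exists_zpow_prec x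
    obtain ⟨t, ht⟩ := hG.exists_zpow_prec y
    have hmem : ∀ (n : ℕ) (z : G) (k : ℕ), Prec M ((Δ : G) ^ (-(k : ℤ))) z → k ≤ n →
        (Δ : G) ^ (n : ℤ) * z ∈ M := by
      intro n z k hk hkn
      have := (zpow_prec_zpow (Δ := Δ) (i := -(n : ℤ)) (j := -(k : ℤ)) (by omega)).trans hk
      simpa [Prec] using this
    set n := r + t
    have hx := hmem n x r hr (by omega)
    have hy := hmem n y t ht (by omega)
    obtain ⟨d, hdx, hdy, hd⟩ := hG.garsideMonoid.gaussian.left_gcd ⟨_, hx⟩ ⟨_, hy⟩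
    rw [coe_dvd_iff] at hdx hdy
    refine ⟨((Δ : G) ^ (n : ℤ))⁻¹ * d, inv_mul_prec_iff.2 hdx, inv_mul_prec_iff.2 hdy, ?_⟩
    -- The gcd in M only dominates lower bounds in M. A general g needs a further shift by Δ^k; the
    -- shifted gcd is divisible by Δ^k, and its cofactor c divides d.
    intro g hgx hgy
    obtain ⟨k, hk⟩ := hG.exists_zpow_prec g
    have hx' := hmem (n + k) x r hr (by omega)
    have hy' := hmem (n + k) y t ht (by omega)
    have hg' := hmem (n + k) g k hk (by omega)
    obtain ⟨d', hdx', hdy', hd'⟩ := hG.garsideMonoid.gaussian.left_gcd ⟨_, hx'⟩ ⟨_, hy'⟩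
    have h1 : (⟨_, hg'⟩ : M) ∣ d' := hd' _ (coe_dvd_iff.2 ((prec_mul_left_iff _).2 hgx))
      (coe_dvd_iff.2 ((prec_mul_left_iff _).2 hgy))
    have hpow : ∀ z : G, (Δ : G) ^ ((n + k : ℕ) : ℤ) * z =
        (Δ : G) ^ (k : ℤ) * ((Δ : G) ^ (n : ℤ) * z) := by
      intro z
      rw [← mul_assoc, ← zpow_add]; congr 2; push_cast; ring
    have h2 : Δ ^ k ∣ d' := by
      refine hd' _ (coe_dvd_iff.2 ?_) (coe_dvd_iff.2 ?_)
      · change Prec M _ ((Δ : G) ^ ((n + k : ℕ) : ℤ) * _)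
        rw [hpow]
        simpa using prec_mul_right (M := M) (x := (Δ : G) ^ (k : ℤ)) hx
      · change Prec M _ ((Δ : G) ^ ((n + k : ℕ) : ℤ) * _)
        rw [hpow]
        simpa using prec_mul_right (M := M) (x := (Δ : G) ^ (k : ℤ)) hy
    obtain ⟨c, rfl⟩ := h2
    rw [coe_dvd_iff] at hdx' hdy' h1
    have hc : ((Δ ^ k * c : M) : G) = (Δ : G) ^ (k : ℤ) * c := by simp
    simp only [hpow, hc, prec_mul_left_iff] at hdx' hdy' h1
    have h3 := hd c (coe_dvd_iff.2 hdx') (coe_dvd_iff.2 hdy')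
    rw [prec_inv_mul_iff]
    exact h1.trans (coe_dvd_iff.1 h3)
  rw [meet, dif_pos hex]
  exact hex.choose_spec

theorem meet_prec_left (x y : G) : Prec M (meet M x y) x := (hG.isGcdFor_meet x y).1

theorem meet_prec_right (x y : G) : Prec M (meet M x y) y := (hG.isGcdFor_meet x y).2.1

theorem prec_meet {x y g : G} (hx : Prec M g x) (hy : Prec M g y) : Prec M g (meet M x y) :=
  (hG.isGcdFor_meet x y).2.2 g hx hy

theorem meet_eq_of {x y d : G} (hx : Prec M d x) (hy : Prec M d y)
    (h : ∀ g, Prec M g x → Prec M g y → Prec M g d) : meet M x y = d :=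
  hG.antisymm (h _ (hG.meet_prec_left x y) (hG.meet_prec_right x y)) (hG.prec_meet hx hy)

theorem meet_eq_left {x y : G} (h : Prec M x y) : meet M x y = x :=
  hG.meet_eq_of (prec_refl _) h fun _ h _ => h

theorem meet_eq_right {x y : G} (h : Prec M y x) : meet M x y = y :=
  hG.meet_eq_of h (prec_refl _) fun _ _ h => h

theorem mul_meet (a x y : G) : a * meet M x y = meet M (a * x) (a * y) := by
  refine (hG.meet_eq_of ?_ ?_ ?_).symm
  · exact (prec_mul_left_iff a).2 (hG.meet_prec_left _ _)
  · exact (prec_mul_left_iff a).2 (hG.meet_prec_right _ _)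
  · intro g h₁ h₂
    rw [← inv_mul_prec_iff] at *
    exact hG.prec_meet h₁ h₂

theorem meet_mul_zpow (x y : G) (k : ℤ) :
    meet M x y * (Δ : G) ^ k = meet M (x * (Δ : G) ^ k) (y * (Δ : G) ^ k) := by
  refine (hG.meet_eq_of ?_ ?_ ?_).symm
  · exact (hG.prec_mul_zpow_iff k).2 (hG.meet_prec_left _ _)
  · exact (hG.prec_mul_zpow_iff k).2 (hG.meet_prec_right _ _)
  · intro g h₁ h₂
    have h : ∀ z, Prec M g (z * (Δ : G) ^ k) ↔ Prec M (g * (Δ : G) ^ (-k)) z := by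
      intro z; rw [hG.mul_zpow_prec_iff, neg_neg]
    rw [h] at *
    exact hG.prec_meet h₁ h₂

theorem prec_mul_zpow_iff_mul_neg (k : ℤ) {x y : G} :
    Prec M x (y * (Δ : G) ^ k) ↔ Prec M (x * (Δ : G) ^ (-k)) y := by
  rw [hG.mul_zpow_prec_iff, neg_neg]

end IsGarsideGroup

end Basic

/-! ### A superadditive, τ-invariant norm on M -/

section Norm

variable {G : Type*} [Group G] {M : Submonoid G} {Δ : M}

/-- The set of lengths of the factorizations of `x` into nontrivial elements of `M`. -/
def factorLengths (M : Submonoid G) (x : G) : Set ℕ :=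
  {n | ∃ l : List G, (∀ a ∈ l, a ∈ M ∧ a ≠ 1) ∧ l.prod = x ∧ l.length = n}

/-- The largest number of factors in a factorization of `x` into nontrivial elements of `M`. -/
noncomputable def factorNorm (M : Submonoid G) (x : G) : ℕ := sSup (factorLengths M x)

theorem factorLengths_nonempty {x : G} (hx : x ∈ M) : (factorLengths M x).Nonempty := by
  by_cases h : x = 1
  · exact ⟨0, [], by simp [h]⟩
  · exact ⟨1, [x], by simp [h, hx]⟩

namespace IsGarsideGroup

variable (hG : IsGarsideGroup M Δ)
include hG

/-- Any factorization into nontrivial elements refines to one into atoms that is at least as long.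
-/
theorem le_atomNorm_of_mem_factorLengths {x : M} {n : ℕ} (hn : n ∈ factorLengths M (x : G)) :
    n ≤ atomNorm x := by
  obtain ⟨l, hl, hx, rfl⟩ := hn
  have key : ∀ l : List G, (∀ a ∈ l, a ∈ M ∧ a ≠ 1) → ∃ l' : List M, (∀ a ∈ l', IsAtomElt a) ∧
      (l'.prod : G) = l.prod ∧ l.length ≤ l'.length := by
    intro l
    induction l with
    | nil => exact fun _ => ⟨[], by simp⟩
    | cons a l ih =>
      intro h
      obtain ⟨l', h1, h2, h3⟩ := ih fun b hb => h b (List.mem_cons_of_mem _ hb)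
      obtain ⟨ha, ha1⟩ := h a List.mem_cons_self
      obtain ⟨la, hla, hprod⟩ := hG.atomic.exists_atoms ⟨a, ha⟩
      refine ⟨la ++ l', ?_, ?_, ?_⟩
      · intro b hb
        rcases List.mem_append.1 hb with hb | hb
        exacts [hla b hb, h1 b hb]
      · simp only [List.prod_append, Submonoid.coe_mul, h2, hprod, List.prod_cons]
      · have : la ≠ [] := by
          rintro rfl
          exact ha1 (by simpa using (congrArg Subtype.val hprod).symm)
        have := List.length_pos_iff.2 this
        simp only [List.length_cons, List.length_append]
        omega
  obtain ⟨l', h1, h2, h3⟩ := key l hl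
  refine h3.trans (le_csSup (hG.atomic.bounded x) ⟨l', h1, ?_, rfl⟩)
  ext
  rw [h2, hx]

theorem bddAbove_factorLengths {x : G} (hx : x ∈ M) : BddAbove (factorLengths M x) :=
  ⟨atomNorm (⟨x, hx⟩ : M), fun _ hn => hG.le_atomNorm_of_mem_factorLengths (x := ⟨x, hx⟩) hn⟩

theorem factorNorm_mem {x : G} (hx : x ∈ M) : factorNorm M x ∈ factorLengths M x :=
  Nat.sSup_mem (factorLengths_nonempty hx) (hG.bddAbove_factorLengths hx)

theorem factorNorm_le_atomNorm (x : M) : factorNorm M (x : G) ≤ atomNorm x :=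
  hG.le_atomNorm_of_mem_factorLengths (hG.factorNorm_mem x.2)

theorem factorNorm_add_le {x y : G} (hx : x ∈ M) (hy : y ∈ M) :
    factorNorm M x + factorNorm M y ≤ factorNorm M (x * y) := by
  obtain ⟨l, h1, h2, h3⟩ := hG.factorNorm_mem hx
  obtain ⟨l', h1', h2', h3'⟩ := hG.factorNorm_mem hy
  refine le_csSup (hG.bddAbove_factorLengths (M.mul_mem hx hy)) ⟨l ++ l', ?_, ?_, ?_⟩
  · intro b hb
    rcases List.mem_append.1 hb with hb | hb
    exacts [h1 b hb, h1' b hb]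
  · rw [List.prod_append, h2, h2']
  · rw [List.length_append, h3, h3']

theorem factorNorm_pos {x : G} (hx : x ∈ M) (h : x ≠ 1) : 0 < factorNorm M x :=
  le_csSup (hG.bddAbove_factorLengths hx) ⟨[x], by simp [h, hx]⟩

theorem factorNorm_conjBy (k : ℤ) (x : G) :
    factorNorm M (conjBy x ((Δ : G) ^ k)) = factorNorm M x := by
  have key : ∀ (k : ℤ) (x : G), factorLengths M x ⊆ factorLengths M (conjBy x ((Δ : G) ^ k)) := by
    rintro k x n ⟨l, h1, rfl, rfl⟩
    have hconj : ∀ a, MulAut.conj ((Δ : G) ^ k)⁻¹ a = conjBy a ((Δ : G) ^ k) := by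
      intro a; simp only [MulAut.conj_apply, conjBy, inv_inv]
    refine ⟨l.map (MulAut.conj ((Δ : G) ^ k)⁻¹), ?_, ?_, by simp⟩
    · intro b hb
      obtain ⟨a, ha, rfl⟩ := List.mem_map.1 hb
      refine ⟨?_, ?_⟩
      · rw [hconj]; exact hG.conjBy_zpow_mem k (h1 a ha).1
      · exact fun h => (h1 a ha).2 ((map_eq_one_iff _ (MulEquiv.injective _)).1 h)
    · rw [List.prod_hom, hconj]
  have : factorLengths M (conjBy x ((Δ : G) ^ k)) = factorLengths M x := by
    refine Set.Subset.antisymm ?_ (key k x)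
    have := key (-k) (conjBy x ((Δ : G) ^ k))
    rwa [conjBy_conjBy, ← zpow_add, add_neg_cancel, zpow_zero, conjBy_one] at this
  rw [factorNorm, this, factorNorm]

end IsGarsideGroup

end Norm

/-! ### Rigidity as a lattice condition -/

section Rigid

variable {G : Type*} [Group G] {M : Submonoid G} {Δ : M}

/-- Lattice characterization of the rigid elements `x` with `Δ ^ p ≺ x ≺ Δ ^ q`: the common lower
bounds of `x` and `x⁻¹ Δ ^ (p + q)` are those of `Δ ^ p`. -/
structure RigidBetween (M : Submonoid G) (Δ : M) (p q : ℤ) (x : G) : Prop where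
  lt : p < q
  lo : Prec M ((Δ : G) ^ p) x
  hi : Prec M x ((Δ : G) ^ q)
  rigid : ∀ g, Prec M g x → Prec M (x * g) ((Δ : G) ^ (p + q)) → Prec M g ((Δ : G) ^ p)
  ne_lo : x ≠ (Δ : G) ^ p
  ne_hi : x ≠ (Δ : G) ^ q

namespace IsGarsideGroup

variable (hG : IsGarsideGroup M Δ)
include hG

theorem zpow_prec_pow {p : ℤ} {x : G} (h : Prec M ((Δ : G) ^ p) x) (n : ℕ) :
    Prec M ((Δ : G) ^ (p * n)) (x ^ n) := by
  induction n with
  | zero => simpa using prec_refl _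
  | succ n ih =>
    have h1 := (prec_mul_left_iff x).2 ih
    rw [← pow_succ'] at h1
    refine Prec.trans ?_ h1
    push_cast
    rw [mul_add, mul_one, add_comm, zpow_add]
    exact (hG.prec_mul_zpow_iff _).2 h

theorem pow_prec_zpow {q : ℤ} {x : G} (h : Prec M x ((Δ : G) ^ q)) (n : ℕ) :
    Prec M (x ^ n) ((Δ : G) ^ (q * n)) := by
  induction n with
  | zero => simpa using prec_refl _
  | succ n ih =>
    have h1 := (prec_mul_left_iff x).2 ih
    rw [← pow_succ'] at h1
    refine h1.trans ?_
    push_cast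
    rw [mul_add, mul_one, add_comm, zpow_add]
    exact (hG.prec_mul_zpow_iff _).2 h

/-- If Δ^e is central, then x^e, being conjugate to Δ^(pe), equals it. Cancelling in xΔ^(p(e-1)) ≺
x^e leaves x ≺ Δ^p. -/
theorem eq_of_conjBy_eq_lo {p : ℤ} {x u : G} (h : Prec M ((Δ : G) ^ p) x)
    (hu : conjBy x u = (Δ : G) ^ p) : x = (Δ : G) ^ p := by
  obtain ⟨e, he, hc⟩ := hG.exists_central
  obtain ⟨n, rfl⟩ : ∃ n, e = n + 1 := ⟨e - 1, by omega⟩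
  have hx : x ^ (n + 1) = (Δ : G) ^ (p * (n + 1 : ℕ)) := by
    have h1 : conjBy (x ^ (n + 1)) u = (Δ : G) ^ (p * (n + 1 : ℕ)) := by
      rw [← conjBy_pow, hu, ← zpow_natCast, ← zpow_mul]
    have h2 := congrArg (fun g => conjBy g u⁻¹) h1
    simp only [conjBy_conjBy, mul_inv_cancel, conjBy_one] at h2
    rw [h2]
    refine conjBy_eq_self ?_
    rw [mul_comm, zpow_mul]
    exact ((hc u⁻¹).zpow_right p).symm
  refine hG.antisymm ?_ h
  have h1 := (prec_mul_left_iff x).2 (hG.zpow_prec_pow h n)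
  rw [← pow_succ', hx, hG.mul_zpow_prec_iff, ← zpow_add] at h1
  convert h1 using 2
  push_cast; ring

theorem eq_of_conjBy_eq_hi {q : ℤ} {x u : G} (h : Prec M x ((Δ : G) ^ q))
    (hu : conjBy x u = (Δ : G) ^ q) : x = (Δ : G) ^ q := by
  obtain ⟨e, he, hc⟩ := hG.exists_central
  obtain ⟨n, rfl⟩ : ∃ n, e = n + 1 := ⟨e - 1, by omega⟩
  have hx : x ^ (n + 1) = (Δ : G) ^ (q * (n + 1 : ℕ)) := by
    have h1 : conjBy (x ^ (n + 1)) u = (Δ : G) ^ (q * (n + 1 : ℕ)) := by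
      rw [← conjBy_pow, hu, ← zpow_natCast, ← zpow_mul]
    have h2 := congrArg (fun g => conjBy g u⁻¹) h1
    simp only [conjBy_conjBy, mul_inv_cancel, conjBy_one] at h2
    rw [h2]
    refine conjBy_eq_self ?_
    rw [mul_comm, zpow_mul]
    exact ((hc u⁻¹).zpow_right q).symm
  refine hG.antisymm h ?_
  have h1 := (prec_mul_left_iff x).2 (hG.pow_prec_zpow h n)
  rw [← pow_succ', hx, hG.prec_mul_zpow_iff_mul_neg, ← zpow_add] at h1
  convert h1 using 2
  push_cast; ring

/-- Induction puts x⁻¹g below xΔ^(np); rigidity applied to x⁻¹gΔ^(-np) then lowers this bound to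
Δ^((n+1)p). -/
theorem prec_mul_zpow_of_prec_pow_succ {p q : ℤ} {x : G} (hx : RigidBetween M Δ p q x) (n : ℕ)
    {g : G} (h₁ : Prec M g (x ^ (n + 1))) (h₂ : Prec M g ((Δ : G) ^ (q + n * p))) :
    Prec M g (x * (Δ : G) ^ (n * p)) := by
  induction n generalizing g with
  | zero => simpa using h₁
  | succ n ih =>
    have h3 : Prec M (x⁻¹ * g) (x * (Δ : G) ^ (n * p)) := by
      refine ih ?_ ?_
      · rwa [inv_mul_prec_iff, ← pow_succ']
      · rw [inv_mul_prec_iff]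
        refine h₂.trans ?_
        have := (hG.prec_mul_zpow_iff (q + n * p)).2 hx.lo
        rw [← zpow_add] at this
        convert this using 2
        push_cast; ring
    rw [hG.prec_mul_zpow_iff_mul_neg] at h3
    have h4 := hx.rigid _ h3 (by
      rw [mul_assoc, mul_inv_cancel_left, hG.mul_zpow_prec_iff, ← zpow_add]
      convert h₂ using 2
      push_cast; ring)
    rw [hG.mul_zpow_prec_iff, neg_neg, inv_mul_prec_iff, ← zpow_add] at h4
    convert h4 using 3
    push_cast; ring

/-- The converse bounds being clear, this computes x^(a+b) ∧ Δ^(aq+bp) = x^a Δ^(bp). Factors x are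
split off one at a time. -/
theorem prec_pow_mul_zpow {p q : ℤ} {x : G} (hx : RigidBetween M Δ p q x) (a b : ℕ)
    {g : G} (h₁ : Prec M g (x ^ (a + b))) (h₂ : Prec M g ((Δ : G) ^ (a * q + b * p))) :
    Prec M g (x ^ a * (Δ : G) ^ (b * p)) := by
  induction a generalizing g with
  | zero => simpa using h₂
  | succ a ih =>
    rw [pow_succ', mul_assoc, ← inv_mul_prec_iff]
    refine ih ?_ ?_
    · rw [inv_mul_prec_iff, ← pow_succ']
      convert h₁ using 2
      ring
    · rw [inv_mul_prec_iff]
      -- Shifting g down by Δ^(a(p-q)) turns the exponent (a+1)q + bp into q + (a+b)p, the one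
      -- handled by the previous lemma.
      have hle : (a : ℤ) * (p - q) ≤ 0 :=
        mul_nonpos_of_nonneg_of_nonpos (by positivity) (by linarith [hx.lt])
      have h3 := hG.prec_mul_zpow_of_prec_pow_succ hx (a + b)
        (g := g * (Δ : G) ^ ((a : ℤ) * (p - q)))
        ((mul_zpow_prec hle g).trans (by convert h₁ using 2; ring))
        (by
          rw [hG.mul_zpow_prec_iff, ← zpow_add]
          convert h₂ using 2
          push_cast; ring)
      rw [hG.mul_zpow_prec_iff, mul_assoc, ← zpow_add] at h3
      convert h3 using 3
      push_cast; ring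

/-- If Δ^(p+1) ≺ x, the restriction g ≺ x is automatic for g ≺ Δ^(p+1), and rigidity forces
x⁻¹Δ^(p+q) = Δ^p, that is x = Δ^q. -/
theorem not_zpow_succ_prec {p q : ℤ} {x : G} (hx : RigidBetween M Δ p q x) :
    ¬ Prec M ((Δ : G) ^ (p + 1)) x := by
  intro h
  have h1 : x⁻¹ * (Δ : G) ^ (p + q) = (Δ : G) ^ p := by
    refine hG.eq_zpow_of_forall ?_ ?_
    · rw [prec_inv_mul_iff, add_comm, zpow_add, hG.prec_mul_zpow_iff]
      exact hx.hi
    · intro g h₁ h₂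
      exact hx.rigid g (h₂.trans h) (prec_inv_mul_iff.1 h₁)
  rw [inv_mul_eq_iff_eq_mul, add_comm, zpow_add, mul_left_inj] at h1
  exact hx.ne_hi h1.symm

theorem not_prec_zpow_pred {p q : ℤ} {x : G} (hx : RigidBetween M Δ p q x) :
    ¬ Prec M x ((Δ : G) ^ (q - 1)) := by
  intro h
  refine hx.ne_lo (hG.eq_zpow_of_forall hx.lo fun g h₁ h₂ => hx.rigid g h₁ ?_)
  have := ((prec_mul_left_iff x).2 h₂).trans ((hG.prec_mul_zpow_iff _).2 h)
  rw [← zpow_add] at this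
  convert this using 2
  ring

theorem not_zpow_succ_prec_pow {p q : ℤ} {x : G} (hx : RigidBetween M Δ p q x) (n : ℕ) :
    ¬ Prec M ((Δ : G) ^ (p * n + 1)) (x ^ n) := by
  intro h
  rcases n with _ | n
  · refine hG.not_zpow_succ_prec hx (Prec.trans ?_ hx.lo)
    have := (hG.prec_mul_zpow_iff p).2 h
    rw [← zpow_add] at this
    simpa [add_comm] using this
  · have := hG.prec_mul_zpow_of_prec_pow_succ hx n h
      (zpow_prec_zpow (by push_cast; linarith [hx.lt]))
    rw [hG.prec_mul_zpow_iff_mul_neg, ← zpow_add] at this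
    refine hG.not_zpow_succ_prec hx ?_
    convert this using 2
    push_cast; ring

theorem rigidBetween_inv {p q : ℤ} {x : G} (hx : RigidBetween M Δ p q x) :
    RigidBetween M Δ (-q) (-p) x⁻¹ where
  lt := by linarith [hx.lt]
  lo := by
    rw [← mul_one x⁻¹, prec_inv_mul_iff, hG.mul_zpow_prec_iff, neg_neg, one_mul]
    exact hx.hi
  hi := by
    rw [← mul_one x⁻¹, inv_mul_prec_iff, ← hG.mul_zpow_prec_iff, one_mul]
    exact hx.lo
  rigid := by
    intro g h₁ h₂
    have h3 := hx.rigid (g * (Δ : G) ^ (p + q)) (by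
        rw [inv_mul_prec_iff] at h₂
        rw [hG.mul_zpow_prec_iff]
        convert h₂ using 3
        ring) (by
        rw [← mul_assoc]
        have := (hG.prec_mul_zpow_iff (p + q)).2 ((prec_mul_left_iff x).2 h₁)
        simpa using this)
    rw [hG.mul_zpow_prec_iff, ← zpow_add] at h3
    convert h3 using 2
    ring
  ne_lo := by
    rw [zpow_neg, ne_eq, inv_inj]
    exact hx.ne_hi
  ne_hi := by
    rw [zpow_neg, ne_eq, inv_inj]
    exact hx.ne_lo

theorem rigidBetween_one_false {p q : ℤ} (hx : RigidBetween M Δ p q (1 : G)) : False := by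
  rcases le_total 0 (p + q) with h | h
  · refine hx.ne_lo (hG.antisymm ?_ hx.lo)
    refine hx.rigid 1 (prec_refl _) ?_
    simpa using zpow_prec_zpow h
  · have := hx.rigid ((Δ : G) ^ (p + q)) (by simpa using zpow_prec_zpow h)
      (by simpa using prec_refl _)
    refine hx.ne_hi (hG.antisymm hx.hi ?_)
    have h2 := (hG.prec_mul_zpow_iff (-p)).2 this
    rw [← zpow_add, ← zpow_add] at h2
    simpa using h2

/-- Here q = p + l. It is enough to test g ≺ Δ^(p+1); such a g below x is below Δ^p x₁, so xgΔ^(-p)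
divides the lengthened word and Δ^q, hence x. -/
theorem rigidBetween_of_isRigid {x : G} (hx : IsRigid M Δ x) :
    ∃ p q, RigidBetween M Δ p q x := by
  obtain ⟨p, x₁, L, rfl, ⟨hs, h₁⟩, -, h₂⟩ := hx
  set x := (Δ : G) ^ p * (x₁ :: L).prod with hxdef
  have hx1 := hs x₁ List.mem_cons_self
  have hlo := h₁ 0 (by simp)
  have h1 := h₁ 1 (by simp)
  have hhi := h₁ (L.length + 1) (by simp)
  have hw := h₂ (L.length + 1) (by simp)
  rw [List.take_of_length_le (by simp)] at hhi
  rw [List.take_append_of_le_length (by simp), List.take_of_length_le (by simp)] at hw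
  rw [← hxdef] at hhi hw
  rw [List.prod_append, ← mul_assoc, ← hxdef, List.prod_singleton] at hw
  simp only [CharP.cast_eq_zero, add_zero, List.take_zero, List.prod_nil, mul_one] at hlo
  simp only [Nat.cast_one, List.take_succ_cons, List.take_zero, List.prod_singleton] at h1
  have hloP : Prec M ((Δ : G) ^ p) x := by rw [← hlo]; exact hG.meet_prec_left _ _
  have hne_lo : x ≠ (Δ : G) ^ p := by
    intro h
    rw [h, hG.meet_eq_left (zpow_prec_zpow (by omega))] at h1
    exact hx1.2.1 (by simpa using h1)
  refine ⟨p, p + (L.length + 1 : ℕ), by push_cast; omega, hloP, ?_, ?_, hne_lo, ?_⟩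
  · have := hG.meet_prec_right x ((Δ : G) ^ (p + (L.length + 1 : ℕ)))
    rwa [hhi] at this
  · intro g hg hg'
    have hd : meet M x (x⁻¹ * (Δ : G) ^ (p + (p + (L.length + 1 : ℕ)))) = (Δ : G) ^ p := by
      refine hG.eq_zpow_of_forall (hG.prec_meet hloP ?_) ?_
      · rw [prec_inv_mul_iff, add_comm, zpow_add _ (p + _), hG.prec_mul_zpow_iff]
        have := hG.meet_prec_right x ((Δ : G) ^ (p + (L.length + 1 : ℕ)))
        rwa [hhi] at this
      · intro g hg hg1
        have hgx := hG.prec_meet (hg.trans (hG.meet_prec_left _ _)) hg1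
        rw [h1] at hgx
        have hgx' : Prec M (x * g) ((Δ : G) ^ (p + (p + (L.length + 1 : ℕ)))) :=
          prec_inv_mul_iff.1 (hg.trans (hG.meet_prec_right _ _))
        have h3 : Prec M (x * g * (Δ : G) ^ (-p)) x := by
          conv_rhs => rw [← hw]
          refine hG.prec_meet ?_ ?_
          · rw [mul_assoc, prec_mul_left_iff, hG.prec_mul_zpow_iff]
            exact hgx
          · rw [hG.mul_zpow_prec_iff, ← zpow_add]
            convert hgx' using 2
            ring
        rw [hG.mul_zpow_prec_iff, neg_neg, prec_mul_left_iff] at h3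
        exact h3
    rw [← hd]
    exact hG.prec_meet hg (prec_inv_mul_iff.2 hg')
  · intro h
    rw [h, hG.meet_eq_right (zpow_prec_zpow (by push_cast; omega)), zpow_add_one] at h1
    exact hx1.2.2 (by simpa using h1.symm)

end IsGarsideGroup

/-- The `i`-th letter of the left normal form of `x`, counted from `Δ ^ p`. -/
noncomputable def letter (M : Submonoid G) (Δ : M) (p : ℤ) (x : G) (i : ℕ) : G :=
  (meet M x ((Δ : G) ^ (p + i)))⁻¹ * meet M x ((Δ : G) ^ (p + (i + 1 : ℕ)))

namespace IsGarsideGroup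

variable (hG : IsGarsideGroup M Δ)
include hG

theorem prod_letters {p : ℤ} {x : G} (hx : Prec M ((Δ : G) ^ p) x) (n : ℕ) :
    (Δ : G) ^ p * ((List.range n).map (letter M Δ p x)).prod =
      meet M x ((Δ : G) ^ (p + n)) := by
  induction n with
  | zero => simp [hG.meet_eq_right hx]
  | succ n ih =>
    rw [List.range_succ, List.map_append, List.prod_append, ← mul_assoc, ih]
    simp [letter]

theorem meet_prec_meet_succ (p : ℤ) (x : G) :
    Prec M (meet M x ((Δ : G) ^ p)) (meet M x ((Δ : G) ^ (p + 1))) :=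
  hG.prec_meet (hG.meet_prec_left _ _)
    ((hG.meet_prec_right _ _).trans (zpow_prec_zpow (by omega)))

theorem meet_succ_prec_meet_mul (p : ℤ) (x : G) :
    Prec M (meet M x ((Δ : G) ^ (p + 1))) (meet M x ((Δ : G) ^ p) * Δ) := by
  have := hG.meet_mul_zpow x ((Δ : G) ^ p) 1
  rw [zpow_one] at this
  rw [this, ← zpow_add_one]
  exact hG.prec_meet ((hG.meet_prec_left _ _).trans (prec_mul_right Δ.2)) (hG.meet_prec_right _ _)

theorem eq_meet_of_meet_succ_eq {p : ℤ} {x : G}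
    (h : meet M x ((Δ : G) ^ (p + 1)) = meet M x ((Δ : G) ^ p)) : x = meet M x ((Δ : G) ^ p) := by
  by_contra hne
  have hmem : (meet M x ((Δ : G) ^ p))⁻¹ * x ∈ M := hG.meet_prec_left x ((Δ : G) ^ p)
  obtain ⟨s, hs, hs1, hsD, hsa⟩ := hG.exists_simple_prec hmem
    (fun h => hne (inv_mul_eq_one.1 h).symm)
  have h1 : Prec M (meet M x ((Δ : G) ^ p) * s) (meet M x ((Δ : G) ^ (p + 1))) := by
    refine hG.prec_meet (prec_inv_mul_iff.1 hsa) ?_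
    refine ((prec_mul_left_iff _).2 hsD).trans ?_
    have := (hG.prec_mul_zpow_iff 1).2 (hG.meet_prec_right x ((Δ : G) ^ p))
    rwa [zpow_one, ← zpow_add_one] at this
  rw [h] at h1
  refine hs1 (hG.eq_one_of_mem_inv_mem hs ?_)
  simpa [Prec] using h1

theorem letter_mem_simples (p : ℤ) (x : G) (i : ℕ) : letter M Δ p x i ∈ simples M Δ := by
  have hp : p + (i + 1 : ℕ) = p + i + 1 := by push_cast; ring
  refine ⟨?_, ?_⟩
  · rw [letter, hp]
    exact hG.meet_prec_meet_succ _ _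
  · rw [letter, hp, inv_mul_prec_iff]
    exact hG.meet_succ_prec_meet_mul _ _

theorem letter_ne_one {p : ℤ} {x : G} {i : ℕ} (hx : ¬ Prec M x ((Δ : G) ^ (p + i))) :
    letter M Δ p x i ≠ 1 := by
  intro h
  have hp : p + (i + 1 : ℕ) = p + i + 1 := by push_cast; ring
  rw [letter, inv_mul_eq_one, hp] at h
  refine hx ?_
  rw [hG.eq_meet_of_meet_succ_eq h.symm]
  exact hG.meet_prec_right _ _

theorem letter_ne_delta {p : ℤ} {x : G} (hlo : Prec M ((Δ : G) ^ p) x)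
    (hx : ¬ Prec M ((Δ : G) ^ (p + 1)) x) (i : ℕ) : letter M Δ p x i ≠ (Δ : G) := by
  have hlet : ∀ i, letter M Δ p x i = (Δ : G) ↔
      Prec M (meet M x ((Δ : G) ^ (p + i)) * Δ) x := by
    intro i
    have hp : p + (i + 1 : ℕ) = p + i + 1 := by push_cast; ring
    rw [letter, inv_mul_eq_iff_eq_mul, hp]
    constructor
    · intro h
      rw [← h]
      exact hG.meet_prec_left _ _
    · intro h
      refine hG.antisymm (hG.meet_succ_prec_meet_mul _ _) (hG.prec_meet h ?_)
      have := (hG.prec_mul_zpow_iff 1).2 (hG.meet_prec_right x ((Δ : G) ^ (p + i)))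
      rwa [zpow_one, ← zpow_add_one] at this
  rw [ne_eq, hlet]
  intro h
  refine hx (Prec.trans ?_ h)
  rw [zpow_add_one]
  have h1 : Prec M ((Δ : G) ^ p) (meet M x ((Δ : G) ^ (p + i))) :=
    hG.prec_meet hlo (zpow_prec_zpow (by omega))
  have := (hG.prec_mul_zpow_iff 1).2 h1
  rwa [zpow_one] at this

/-- The normal form consists of the quotients of successive meets x ∧ Δ^(p+i). The rigidity
condition says that appending the twisted first letter does not change the meet with Δ^q, nor
therefore the earlier ones. -/
theorem isRigid_of_rigidBetween {p q : ℤ} {x : G} (hx : RigidBetween M Δ p q x) :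
    IsRigid M Δ x := by
  obtain ⟨l, rfl⟩ : ∃ l : ℕ, q = p + (l + 1 : ℕ) :=
    ⟨(q - p - 1).toNat, by have := hx.lt; push_cast; omega⟩
  set L := (List.range (l + 1)).map (letter M Δ p x) with hL
  set x₁ := letter M Δ p x 0 with hx₁
  have hcons : L = x₁ :: (List.range l).map (fun i => letter M Δ p x (i + 1)) := by
    rw [hL, List.range_succ_eq_map, List.map_cons, List.map_map]
    rfl
  have hprod : (Δ : G) ^ p * L.prod = x := by
    rw [hL, hG.prod_letters hx.lo, hG.meet_eq_left hx.hi]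
  have hlen : L.length = l + 1 := by simp [hL]
  have htake : ∀ i ≤ l + 1, (Δ : G) ^ p * (L.take i).prod = meet M x ((Δ : G) ^ (p + i)) := by
    intro i hi
    rw [hL, ← List.map_take, List.take_range, min_eq_left hi, hG.prod_letters hx.lo]
  have hsimple : ∀ s ∈ L, s ∈ simples M Δ ∧ s ≠ 1 ∧ s ≠ (Δ : G) := by
    intro s hs
    obtain ⟨i, hi, rfl⟩ := List.mem_map.1 hs
    rw [List.mem_range] at hi
    refine ⟨hG.letter_mem_simples p x i, hG.letter_ne_one fun h => ?_,
      hG.letter_ne_delta hx.lo (hG.not_zpow_succ_prec hx) i⟩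
    exact hG.not_prec_zpow_pred hx (h.trans (zpow_prec_zpow (by push_cast; omega)))
  have hx₁D : (Δ : G) ^ p * x₁ = meet M x ((Δ : G) ^ (p + 1)) := by
    have := htake 1 (by omega)
    rw [hcons] at this
    simpa using this
  have hlast : ∀ g, Prec M g (x * (meet M x ((Δ : G) ^ (p + 1)) * (Δ : G) ^ (-p))) →
      Prec M g ((Δ : G) ^ (p + (l + 1 : ℕ))) → Prec M g x := by
    intro g h₁ h₂
    rw [← inv_mul_prec_iff, hG.prec_mul_zpow_iff_mul_neg, neg_neg] at h₁
    have := hx.rigid _ (h₁.trans (hG.meet_prec_left _ _)) (by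
      rw [mul_assoc, mul_inv_cancel_left, hG.mul_zpow_prec_iff, ← zpow_add]
      convert h₂ using 2
      ring)
    nth_rw 2 [← one_mul ((Δ : G) ^ p)] at this
    rwa [hG.prec_mul_zpow_iff, inv_mul_prec_iff, mul_one] at this
  have hpos : Prec M x (x * (meet M x ((Δ : G) ^ (p + 1)) * (Δ : G) ^ (-p))) := by
    nth_rw 1 [← mul_one x]
    rw [prec_mul_left_iff, ← hG.mul_zpow_prec_iff, one_mul]
    exact hG.prec_meet hx.lo (zpow_prec_zpow (by omega))
  refine ⟨p, x₁, (List.range l).map (fun i => letter M Δ p x (i + 1)), ?_, ?_, ?_⟩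
  · rw [← hcons, hprod]
  · rw [← hcons]
    refine ⟨hsimple, fun i hi => ?_⟩
    rw [hprod, htake i (by omega)]
  · rw [← hcons]
    refine ⟨?_, ?_⟩
    · intro s hs
      rcases List.mem_append.1 hs with hs | hs
      · exact hsimple s hs
      · rw [List.mem_singleton] at hs
        subst hs
        obtain ⟨⟨h1, h2⟩, h3, h4⟩ := hsimple x₁ (by rw [hcons]; exact List.mem_cons_self)
        have hconj : (Δ : G) ^ p * x₁ * (Δ : G) ^ (-p) = conjBy x₁ ((Δ : G) ^ (-p)) := by
          simp [conjBy]
        have hD : conjBy (Δ : G) ((Δ : G) ^ (-p)) = Δ := conjBy_eq_self (Commute.self_zpow _ _)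
        rw [hconj]
        refine ⟨⟨hG.conjBy_zpow_mem _ h1, ?_⟩, fun h => h3 ?_, fun h => h4 ?_⟩
        · have := hG.conjBy_zpow_mem (-p) h2
          rw [Prec]
          nth_rw 2 [← hD]
          simpa [conjBy, mul_assoc] using this
        · simpa [conjBy] using h
        · nth_rw 2 [← hD] at h
          simpa [conjBy] using h
    · rw [List.prod_append, List.prod_singleton, ← mul_assoc _ L.prod, hprod, hx₁D,
        List.length_append, hlen]
      intro i hi
      rw [List.length_singleton] at hi
      rcases Nat.lt_or_ge (l + 1) i with h | h
      · obtain rfl : i = l + 1 + 1 := by omega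
        rw [List.take_of_length_le (by simp [hlen]), List.prod_append, List.prod_singleton,
          ← mul_assoc _ L.prod, hprod]
        refine hG.meet_eq_left ?_
        have h1 := ((prec_mul_left_iff x).2 (hG.meet_prec_right x ((Δ : G) ^ (p + 1)))).trans
          ((hG.prec_mul_zpow_iff (p + 1)).2 hx.hi)
        rw [← mul_assoc, hG.mul_zpow_prec_iff, neg_neg]
        rw [← zpow_add] at h1 ⊢
        convert h1 using 2
        push_cast; ring
      · rw [List.take_append_of_le_length (by omega), htake i h]
        refine hG.meet_eq_of ((hG.meet_prec_left _ _).trans hpos) (hG.meet_prec_right _ _) ?_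
        intro g h₁ h₂
        exact hG.prec_meet (hlast g h₁ (h₂.trans (zpow_prec_zpow (by push_cast; omega)))) h₂

theorem isRigid_iff {x : G} : IsRigid M Δ x ↔ ∃ p q, RigidBetween M Δ p q x :=
  ⟨hG.rigidBetween_of_isRigid, fun ⟨_, _, h⟩ => hG.isRigid_of_rigidBetween h⟩

end IsGarsideGroup

end Rigid

/-! ### Meet-closed conjugator sets, transport and recurrence -/

section Summit

variable {G : Type*} [Group G] {M : Submonoid G} {Δ : M}

/-- A property of elements whose set of conjugators `{u | C (y ^ u)}` is always closed under `∧`,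
and which is invariant under `τ`. -/
structure MeetStable (M : Submonoid G) (Δ : M) (C : G → Prop) : Prop where
  meet : ∀ y u v, C (conjBy y u) → C (conjBy y v) → C (conjBy y (meet M u v))
  twist : ∀ y (i : ℤ), C y → C (conjBy y ((Δ : G) ^ i))

theorem MeetStable.and {C C' : G → Prop} (h : MeetStable M Δ C) (h' : MeetStable M Δ C') :
    MeetStable M Δ (fun y => C y ∧ C' y) :=
  ⟨fun y u v hu hv => ⟨h.meet y u v hu.1 hv.1, h'.meet y u v hu.2 hv.2⟩,
    fun y i hy => ⟨h.twist y i hy.1, h'.twist y i hy.2⟩⟩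

/-- Cycling conjugates by the meet of y^m, which fixes y, and Δ^k, which preserves C. -/
theorem MeetStable.cyc {C : G → Prop} (h : MeetStable M Δ C) {y : G} (hy : C y) (m k : ℤ) :
    C (cyc M Δ m k y) := by
  refine h.meet y _ _ ?_ (h.twist y k hy)
  rwa [conjBy_eq_self (Commute.self_zpow y m)]

theorem zpow_prec_conjBy_iff {s : ℤ} {x u : G} :
    Prec M ((Δ : G) ^ s) (conjBy x u) ↔ Prec M (u * (Δ : G) ^ s) (x * u) := by
  rw [← mul_conjBy x u, prec_mul_left_iff]

theorem conjBy_prec_zpow_iff {s : ℤ} {x u : G} :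
    Prec M (conjBy x u) ((Δ : G) ^ s) ↔ Prec M (x * u) (u * (Δ : G) ^ s) := by
  rw [← mul_conjBy, prec_mul_left_iff]

namespace IsGarsideGroup

variable (hG : IsGarsideGroup M Δ)
include hG

theorem zpow_prec_conjBy_zpow_iff {s i : ℤ} {x : G} :
    Prec M ((Δ : G) ^ s) (conjBy x ((Δ : G) ^ i)) ↔ Prec M ((Δ : G) ^ s) x := by
  rw [zpow_prec_conjBy_iff, ((Commute.refl (Δ : G)).zpow_zpow i s).eq, hG.prec_mul_zpow_iff]

theorem conjBy_zpow_prec_zpow_iff {s i : ℤ} {x : G} :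
    Prec M (conjBy x ((Δ : G) ^ i)) ((Δ : G) ^ s) ↔ Prec M x ((Δ : G) ^ s) := by
  rw [conjBy_prec_zpow_iff, ((Commute.refl (Δ : G)).zpow_zpow i s).eq, hG.prec_mul_zpow_iff]

/-- For a conjugator u the condition reads uΔ^s ≺ y^k u, and both sides commute with meets in u. -/
theorem meetStable_lo (k s : ℤ) : MeetStable M Δ (fun y => Prec M ((Δ : G) ^ s) (y ^ k)) where
  meet y u v hu hv := by
    rw [conjBy_zpow, zpow_prec_conjBy_iff] at *
    rw [hG.meet_mul_zpow, hG.mul_meet]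
    exact hG.prec_meet ((hG.meet_prec_left _ _).trans hu) ((hG.meet_prec_right _ _).trans hv)
  twist y i hy := by
    rwa [conjBy_zpow, hG.zpow_prec_conjBy_zpow_iff]

theorem meetStable_hi (k s : ℤ) : MeetStable M Δ (fun y => Prec M (y ^ k) ((Δ : G) ^ s)) where
  meet y u v hu hv := by
    rw [conjBy_zpow, conjBy_prec_zpow_iff] at *
    rw [hG.meet_mul_zpow, hG.mul_meet]
    exact hG.prec_meet ((hG.meet_prec_left _ _).trans hu) ((hG.meet_prec_right _ _).trans hv)
  twist y i hy := by
    rwa [conjBy_zpow, hG.conjBy_zpow_prec_zpow_iff]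

/-- For w = u or v, rigidity of x^w applied to w⁻¹(u ∧ v)g gives (u ∧ v)g ≺ wΔ^p; the meet of the
two bounds is (u ∧ v)Δ^p. -/
theorem rigidBetween_conjBy_meet {p q : ℤ} {x u v : G} (hu : RigidBetween M Δ p q (conjBy x u))
    (hv : RigidBetween M Δ p q (conjBy x v)) :
    RigidBetween M Δ p q (conjBy x (meet M u v)) := by
  have hlo := (hG.meetStable_lo 1 p).meet x u v (by simpa using hu.lo) (by simpa using hv.lo)
  have hhi := (hG.meetStable_hi 1 q).meet x u v (by simpa using hu.hi) (by simpa using hv.hi)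
  rw [zpow_one] at hlo hhi
  have hback : conjBy x u = conjBy (conjBy x (meet M u v)) ((meet M u v)⁻¹ * u) := by
    rw [conjBy_conjBy, mul_inv_cancel_left]
  have key : ∀ w, RigidBetween M Δ p q (conjBy x w) → Prec M (meet M u v) w → ∀ g,
      Prec M g (conjBy x (meet M u v)) →
      Prec M (conjBy x (meet M u v) * g) ((Δ : G) ^ (p + q)) →
      Prec M (meet M u v * g) (w * (Δ : G) ^ p) := by
    intro w hw hmw g h₁ h₂
    rw [← inv_mul_prec_iff]
    refine hw.rigid _ ?_ ?_
    · rw [inv_mul_prec_iff, mul_conjBy]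
      have := (prec_mul_left_iff (meet M u v)).2 h₁
      rw [mul_conjBy] at this
      exact this.trans ((prec_mul_left_iff x).2 hmw)
    · have := (prec_mul_left_iff (meet M u v)).2 h₂
      rw [← mul_assoc, mul_conjBy] at this
      have h3 := this.trans ((hG.prec_mul_zpow_iff (p + q)).2 hmw)
      rw [← inv_mul_prec_iff] at h3
      convert h3 using 1
      simp [conjBy, mul_assoc]
  refine ⟨hu.lt, hlo, hhi, ?_, ?_, ?_⟩
  · intro g h₁ h₂
    have := hG.prec_meet (key u hu (hG.meet_prec_left _ _) g h₁ h₂)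
      (key v hv (hG.meet_prec_right _ _) g h₁ h₂)
    rwa [← hG.meet_mul_zpow, prec_mul_left_iff] at this
  · intro h
    refine hu.ne_lo (hG.eq_of_conjBy_eq_lo (u := ((meet M u v)⁻¹ * u)⁻¹) hu.lo ?_)
    rw [hback, conjBy_conjBy, mul_inv_cancel, conjBy_one, h]
  · intro h
    refine hu.ne_hi (hG.eq_of_conjBy_eq_hi (u := ((meet M u v)⁻¹ * u)⁻¹) hu.hi ?_)
    rw [hback, conjBy_conjBy, mul_inv_cancel, conjBy_one, h]

theorem rigidBetween_conjBy_zpow {p q : ℤ} {x : G} (hx : RigidBetween M Δ p q x) (i : ℤ) :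
    RigidBetween M Δ p q (conjBy x ((Δ : G) ^ i)) := by
  have hself : ∀ s : ℤ, conjBy ((Δ : G) ^ s) ((Δ : G) ^ i) = (Δ : G) ^ s :=
    fun s => conjBy_eq_self ((Commute.refl (Δ : G)).zpow_zpow s i)
  have hinj : ∀ s : ℤ, conjBy x ((Δ : G) ^ i) = (Δ : G) ^ s → x = (Δ : G) ^ s := by
    intro s h
    rw [← hself s] at h
    simpa [conjBy] using h
  refine ⟨hx.lt, hG.zpow_prec_conjBy_zpow_iff.2 hx.lo, hG.conjBy_zpow_prec_zpow_iff.2 hx.hi, ?_,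
    fun h => hx.ne_lo (hinj _ h), fun h => hx.ne_hi (hinj _ h)⟩
  intro g h₁ h₂
  have hg : g = conjBy (conjBy g ((Δ : G) ^ (-i))) ((Δ : G) ^ i) := by
    rw [conjBy_conjBy, ← zpow_add, neg_add_cancel, zpow_zero, conjBy_one]
  rw [hg, hG.conjBy_zpow_prec_zpow_iff]
  refine hx.rigid _ ?_ ?_
  · have := hG.conjBy_zpow_mem (-i) h₁
    simpa [conjBy, Prec, mul_assoc] using this
  · rw [← hG.conjBy_zpow_prec_zpow_iff (i := i)]
    convert h₂ using 1
    simp [conjBy, mul_assoc]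

theorem meetStable_rigidBetween (p q m : ℤ) :
    MeetStable M Δ (fun y => RigidBetween M Δ p q (y ^ m)) where
  meet y u v hu hv := by
    rw [conjBy_zpow] at *
    exact hG.rigidBetween_conjBy_meet hu hv
  twist y i hy := by
    rw [conjBy_zpow]
    exact hG.rigidBetween_conjBy_zpow hy i

theorem mul_meet_conjBy (x u : G) (m k : ℤ) :
    u * meet M ((conjBy x u) ^ m) ((Δ : G) ^ k) = meet M (x ^ m * u) (u * (Δ : G) ^ k) := by
  rw [hG.mul_meet, conjBy_zpow, mul_conjBy]

/-- It says that the transport of u, which conjugates the cycling of x to that of x^u, stays in M.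
-/
theorem meet_prec_transport (x : G) {u : G} (hu : u ∈ M) (m k : ℤ) :
    Prec M (meet M (x ^ m) ((Δ : G) ^ k)) (u * meet M ((conjBy x u) ^ m) ((Δ : G) ^ k)) := by
  rw [hG.mul_meet_conjBy]
  refine hG.prec_meet ((hG.meet_prec_left _ _).trans (prec_mul_right hu))
    ((hG.meet_prec_right _ _).trans ?_)
  have := (hG.prec_mul_zpow_iff k).2 (one_prec_iff.2 hu)
  rwa [one_mul] at this

theorem transport_prec (x : G) {u : G} {j : ℤ} (hu : Prec M u ((Δ : G) ^ j)) (m k : ℤ) :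
    Prec M (u * meet M ((conjBy x u) ^ m) ((Δ : G) ^ k))
      (meet M (x ^ m) ((Δ : G) ^ k) * (Δ : G) ^ j) := by
  rw [hG.mul_meet_conjBy, hG.meet_mul_zpow]
  refine hG.prec_meet ((hG.meet_prec_left _ _).trans ((prec_mul_left_iff _).2 hu))
    ((hG.meet_prec_right _ _).trans ?_)
  rw [((Commute.refl (Δ : G)).zpow_zpow k j).eq]
  exact (hG.prec_mul_zpow_iff k).2 hu

/-- Multiplying u by a large central power of Δ brings it into M. -/
theorem exists_mem_conjBy_eq (x u : G) : ∃ v ∈ M, conjBy x v = conjBy x u := by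
  obtain ⟨e, he, hc⟩ := hG.exists_central
  obtain ⟨r, hr⟩ := hG.exists_zpow_prec u
  refine ⟨u * (Δ : G) ^ ((e : ℤ) * r), ?_, ?_⟩
  · rw [← one_prec_iff, hG.prec_mul_zpow_iff_mul_neg, one_mul]
    refine (zpow_prec_zpow ?_).trans hr
    nlinarith
  · rw [← conjBy_conjBy, conjBy_eq_self]
    rw [zpow_mul]
    exact (hc _).zpow_right _

omit hG in
/-- A periodic point of `c` at which a monovariant would drop does not exist. -/
theorem not_of_periodic {α : Type*} {c : α → α} {P : α → ℕ → Prop} {bad : α → Prop}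
    (hstep : ∀ y n, P y n → P (c y) n) (hdrop : ∀ y n, P y n → bad y → 0 < n ∧ P (c y) (n - 1))
    {y : α} (hper : ∃ N, 0 < N ∧ c^[N] y = y) {n : ℕ} (hP : P y n) : ¬ bad y := by
  intro hbad
  induction n with
  | zero => exact absurd (hdrop y 0 hP hbad).1 (lt_irrefl 0)
  | succ n ih =>
    obtain ⟨N, hN, hper⟩ := hper
    obtain ⟨N, rfl⟩ : ∃ N', N = N' + 1 := ⟨N - 1, by omega⟩
    have hiter : ∀ k z, P z n → P (c^[k] z) n := by
      intro k
      induction k with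
      | zero => exact fun z h => h
      | succ k ihk => exact fun z h => ihk _ (hstep z n h)
    refine ih ?_
    have := hiter N _ (hdrop y (n + 1) hP hbad).2
    rwa [← Function.iterate_succ_apply, hper] at this

/-- With b = y ∧ Δ^p, the transported conjugator v' satisfies v' · b⁻¹Δ^p = τ^p(v), so its norm
drops unless b = Δ^p. -/
theorem zpow_prec_of_recurrent {p : ℤ} {x u : G} (hx : Prec M ((Δ : G) ^ p) x)
    (hy : conjBy x u ∈ recurrenceSet M Δ 1 p) : Prec M ((Δ : G) ^ p) (conjBy x u) := by
  obtain ⟨v, hv, hvu⟩ := hG.exists_mem_conjBy_eq x u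
  rw [← hvu] at hy ⊢
  have key : ∀ x v : G, Prec M ((Δ : G) ^ p) x → v ∈ M → ∃ x' v',
      Prec M ((Δ : G) ^ p) x' ∧ v' ∈ M ∧ cyc M Δ 1 p (conjBy x v) = conjBy x' v' ∧
      factorNorm M v' ≤ factorNorm M v ∧
      (meet M (conjBy x v) ((Δ : G) ^ p) ≠ (Δ : G) ^ p →
        factorNorm M v' + 1 ≤ factorNorm M v) := by
    intro x v hx hv
    set b := meet M (conjBy x v) ((Δ : G) ^ p) with hb
    have hbM : b⁻¹ * (Δ : G) ^ p ∈ M := hG.meet_prec_right _ _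
    have hv' : ((Δ : G) ^ p)⁻¹ * (v * b) ∈ M := by
      have := hG.meet_prec_transport x hv 1 p
      rwa [zpow_one, zpow_one, hG.meet_eq_right hx] at this
    have hnorm := hG.factorNorm_add_le hv' hbM
    have heq : ((Δ : G) ^ p)⁻¹ * (v * b) * (b⁻¹ * (Δ : G) ^ p) = conjBy v ((Δ : G) ^ p) := by
      simp [conjBy, mul_assoc]
    rw [heq, hG.factorNorm_conjBy] at hnorm
    refine ⟨conjBy x ((Δ : G) ^ p), ((Δ : G) ^ p)⁻¹ * (v * b), hG.zpow_prec_conjBy_zpow_iff.2 hx,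
      hv', ?_, by omega, fun hne => ?_⟩
    · rw [cyc, zpow_one, conjBy_conjBy, conjBy_conjBy, mul_inv_cancel_left]
    · have := hG.factorNorm_pos hbM (fun h => hne (inv_mul_eq_one.1 h))
      omega
  have hbad := not_of_periodic (c := cyc M Δ 1 p)
    (P := fun y n => ∃ x v, Prec M ((Δ : G) ^ p) x ∧ v ∈ M ∧ y = conjBy x v ∧ factorNorm M v ≤ n)
    (bad := fun y => meet M y ((Δ : G) ^ p) ≠ (Δ : G) ^ p) ?_ ?_ hy ⟨x, v, hx, hv, rfl, le_rfl⟩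
  · rw [not_not] at hbad
    rw [← hbad]
    exact hG.meet_prec_left _ _
  · rintro y n ⟨x, v, hx, hv, rfl, hn⟩
    obtain ⟨x', v', h1, h2, h3, h4, -⟩ := key x v hx hv
    exact ⟨x', v', h1, h2, h3, h4.trans hn⟩
  · rintro y n ⟨x, v, hx, hv, rfl, hn⟩ hne
    obtain ⟨x', v', h1, h2, h3, -, h4⟩ := key x v hx hv
    have := h4 hne
    exact ⟨by omega, x', v', h1, h2, h3, by omega⟩

/-- Cycling fixes x, and v' · b⁻¹y = v with b = y ∧ Δ^q, so the norm drops unless b = y. -/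
theorem prec_zpow_of_recurrent {q : ℤ} {x u : G} (hx : Prec M x ((Δ : G) ^ q))
    (hy : conjBy x u ∈ recurrenceSet M Δ 1 q) : Prec M (conjBy x u) ((Δ : G) ^ q) := by
  obtain ⟨v, hv, hvu⟩ := hG.exists_mem_conjBy_eq x u
  rw [← hvu] at hy ⊢
  have key : ∀ v : G, v ∈ M → ∃ v',
      v' ∈ M ∧ cyc M Δ 1 q (conjBy x v) = conjBy x v' ∧
      factorNorm M v' ≤ factorNorm M v ∧
      (meet M (conjBy x v) ((Δ : G) ^ q) ≠ conjBy x v →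
        factorNorm M v' + 1 ≤ factorNorm M v) := by
    intro v hv
    set b := meet M (conjBy x v) ((Δ : G) ^ q) with hb
    have hbM : b⁻¹ * conjBy x v ∈ M := hG.meet_prec_left _ _
    have hv' : x⁻¹ * (v * b) ∈ M := by
      have := hG.meet_prec_transport x hv 1 q
      rwa [zpow_one, zpow_one, hG.meet_eq_left hx] at this
    have hnorm := hG.factorNorm_add_le hv' hbM
    have heq : x⁻¹ * (v * b) * (b⁻¹ * conjBy x v) = v := by
      simp [conjBy, mul_assoc]
    rw [heq] at hnorm
    refine ⟨x⁻¹ * (v * b), hv', ?_, by omega, fun hne => ?_⟩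
    · rw [cyc, zpow_one, conjBy_conjBy, ← conjBy_conjBy x x⁻¹,
        conjBy_eq_self (Commute.refl x).inv_right]
    · have := hG.factorNorm_pos hbM (fun h => hne (inv_mul_eq_one.1 h))
      omega
  have hbad := not_of_periodic (c := cyc M Δ 1 q)
    (P := fun y n => ∃ v, v ∈ M ∧ y = conjBy x v ∧ factorNorm M v ≤ n)
    (bad := fun y => meet M y ((Δ : G) ^ q) ≠ y) ?_ ?_ hy ⟨v, hv, rfl, le_rfl⟩
  · rw [not_not] at hbad
    rw [← hbad]
    exact hG.meet_prec_right _ _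
  · rintro y n ⟨v, hv, rfl, hn⟩
    obtain ⟨v', h2, h3, h4, -⟩ := key v hv
    exact ⟨v', h2, h3, h4.trans hn⟩
  · rintro y n ⟨v, hv, rfl, hn⟩ hne
    obtain ⟨v', h2, h3, -, h4⟩ := key v hv
    have := h4 hne
    exact ⟨by omega, v', h2, h3, by omega⟩

theorem meet_sq_eq {p q : ℤ} {x : G} (hx : RigidBetween M Δ p q x) :
    meet M (x ^ (2 : ℤ)) ((Δ : G) ^ (p + q)) = x * (Δ : G) ^ p := by
  rw [zpow_two]
  refine hG.meet_eq_of ((prec_mul_left_iff x).2 hx.lo) ?_ ?_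
  · rw [add_comm, zpow_add, hG.prec_mul_zpow_iff]; exact hx.hi
  · intro g h₁ h₂
    rw [← inv_mul_prec_iff] at h₁ ⊢
    exact hx.rigid _ h₁ (by simpa using h₂)

/-- Here the norm grows: with b = y² ∧ Δ^(p+q), v' = τ^p(v) · (yΔ^p)⁻¹b. Transport preserves v ≺
Δ^j, which bounds the norm, so b = yΔ^p. -/
theorem rigidBetween_of_recurrent {p q : ℤ} {x u : G} (hx : RigidBetween M Δ p q x)
    (hlo : conjBy x u ∈ recurrenceSet M Δ 1 p) (hhi : conjBy x u ∈ recurrenceSet M Δ 1 q)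
    (hsq : conjBy x u ∈ recurrenceSet M Δ 2 (p + q)) : RigidBetween M Δ p q (conjBy x u) := by
  have hylo := hG.zpow_prec_of_recurrent hx.lo hlo
  have hyhi := hG.prec_zpow_of_recurrent hx.hi hhi
  obtain ⟨v, hv, hvu⟩ := hG.exists_mem_conjBy_eq x u
  rw [← hvu] at hsq hylo hyhi ⊢
  obtain ⟨j, hj⟩ := hG.exists_prec_zpow v
  have hle : ∀ v ∈ M, Prec M v ((Δ : G) ^ (j : ℤ)) →
      factorNorm M v ≤ factorNorm M ((Δ : G) ^ (j : ℤ)) := by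
    intro v hv hvj
    have := hG.factorNorm_add_le hv hvj
    rw [mul_inv_cancel_left] at this
    omega
  have hstab := (hG.meetStable_lo 1 p).and (hG.meetStable_hi 1 q)
  have key : ∀ x v : G, RigidBetween M Δ p q x → v ∈ M → Prec M v ((Δ : G) ^ (j : ℤ)) →
      Prec M ((Δ : G) ^ p) (conjBy x v) → Prec M (conjBy x v) ((Δ : G) ^ q) → ∃ x' v',
      RigidBetween M Δ p q x' ∧ v' ∈ M ∧ Prec M v' ((Δ : G) ^ (j : ℤ)) ∧
      cyc M Δ 2 (p + q) (conjBy x v) = conjBy x' v' ∧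
      Prec M ((Δ : G) ^ p) (conjBy x' v') ∧ Prec M (conjBy x' v') ((Δ : G) ^ q) ∧
      factorNorm M v ≤ factorNorm M v' ∧
      (meet M (conjBy x v ^ (2 : ℤ)) ((Δ : G) ^ (p + q)) ≠ conjBy x v * (Δ : G) ^ p →
        factorNorm M v + 1 ≤ factorNorm M v') := by
    intro x v hx hv hvj hlo hhi
    have hC := hstab.cyc (y := conjBy x v) (by simpa using ⟨hlo, hhi⟩) 2 (p + q)
    simp only [zpow_one] at hC
    set b := meet M (conjBy x v ^ (2 : ℤ)) ((Δ : G) ^ (p + q)) with hb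
    have hbM : (conjBy x v * (Δ : G) ^ p)⁻¹ * b ∈ M := by
      refine hG.prec_meet ?_ ?_
      · rw [zpow_two, prec_mul_left_iff]; exact hlo
      · rw [add_comm, zpow_add, hG.prec_mul_zpow_iff]; exact hhi
    have hv' : (x * (Δ : G) ^ p)⁻¹ * (v * b) ∈ M := by
      have := hG.meet_prec_transport x hv 2 (p + q)
      rwa [hG.meet_sq_eq hx] at this
    have hv'j : Prec M ((x * (Δ : G) ^ p)⁻¹ * (v * b)) ((Δ : G) ^ (j : ℤ)) := by
      have := hG.transport_prec x hvj 2 (p + q)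
      rwa [hG.meet_sq_eq hx, ← inv_mul_prec_iff] at this
    have hnorm := hG.factorNorm_add_le (hG.conjBy_zpow_mem p hv) hbM
    have heq : conjBy v ((Δ : G) ^ p) * ((conjBy x v * (Δ : G) ^ p)⁻¹ * b) =
        (x * (Δ : G) ^ p)⁻¹ * (v * b) := by
      simp [conjBy, mul_assoc]
    have hcyc : cyc M Δ 2 (p + q) (conjBy x v) =
        conjBy (conjBy x ((Δ : G) ^ p)) ((x * (Δ : G) ^ p)⁻¹ * (v * b)) := by
      have h1 : conjBy x ((Δ : G) ^ p) = conjBy x (x * (Δ : G) ^ p) := by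
        rw [← conjBy_conjBy x x, conjBy_eq_self (Commute.refl x)]
      rw [cyc, h1, conjBy_conjBy, conjBy_conjBy, mul_inv_cancel_left]
    rw [hcyc] at hC
    rw [heq, hG.factorNorm_conjBy] at hnorm
    refine ⟨conjBy x ((Δ : G) ^ p), (x * (Δ : G) ^ p)⁻¹ * (v * b),
      hG.rigidBetween_conjBy_zpow hx p, hv', hv'j, hcyc, hC.1, hC.2, by omega, fun hne => ?_⟩
    have := hG.factorNorm_pos hbM (fun h => hne (inv_mul_eq_one.1 h).symm)
    omega
  have hbad := not_of_periodic (c := cyc M Δ 2 (p + q))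
    (P := fun y n => ∃ x v, RigidBetween M Δ p q x ∧ v ∈ M ∧ Prec M v ((Δ : G) ^ (j : ℤ)) ∧
      Prec M ((Δ : G) ^ p) y ∧ Prec M y ((Δ : G) ^ q) ∧ y = conjBy x v ∧
      factorNorm M ((Δ : G) ^ (j : ℤ)) ≤ factorNorm M v + n)
    (bad := fun y => meet M (y ^ (2 : ℤ)) ((Δ : G) ^ (p + q)) ≠ y * (Δ : G) ^ p) ?_ ?_ hsq
    ⟨x, v, hx, hv, hj, hylo, hyhi, rfl, Nat.le_add_left _ _⟩
  · rw [not_not] at hbad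
    refine ⟨hx.lt, hylo, hyhi, ?_, ?_, ?_⟩
    · intro g h₁ h₂
      have := hG.prec_meet (x := conjBy x v ^ (2 : ℤ))
        (by rw [zpow_two, prec_mul_left_iff]; exact h₁) h₂
      rwa [hbad, prec_mul_left_iff] at this
    · exact fun h => hx.ne_lo (hG.eq_of_conjBy_eq_lo hx.lo h)
    · exact fun h => hx.ne_hi (hG.eq_of_conjBy_eq_hi hx.hi h)
  · rintro y n ⟨x, v, hx, hv, hvj, h1, h2, rfl, hn⟩
    obtain ⟨x', v', h3, h4, h5, h6, h7, h8, h9, -⟩ := key x v hx hv hvj h1 h2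
    exact ⟨x', v', h3, h4, h5, h6 ▸ h7, h6 ▸ h8, h6, by omega⟩
  · rintro y n ⟨x, v, hx, hv, hvj, h1, h2, rfl, hn⟩ hne
    obtain ⟨x', v', h3, h4, h5, h6, h7, h8, -, h9⟩ := key x v hx hv hvj h1 h2
    have h10 := h9 hne
    have h11 := hle v' h4 h5
    exact ⟨by omega, x', v', h3, h4, h5, h6 ▸ h7, h6 ▸ h8, h6, by omega⟩

theorem iterate_cyc_of_le {m k : ℤ} {x : G} (hx : Prec M ((Δ : G) ^ k) (x ^ m)) (N : ℕ) :
    (cyc M Δ m k)^[N] x = conjBy x ((Δ : G) ^ (k * N)) := by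
  induction N with
  | zero => simp [conjBy]
  | succ N ih =>
    rw [Function.iterate_succ_apply', ih, cyc, conjBy_zpow, hG.meet_eq_right
      (hG.zpow_prec_conjBy_zpow_iff.2 hx), conjBy_conjBy, ← zpow_add]
    congr 2
    push_cast; ring

/-- The product of successive conjugators is a meet of four terms; the two mixed ones, x^m Δ^(kN)
and x^(mN) Δ^k, are redundant by `prec_pow_mul_zpow`. -/
theorem iterate_cyc_of_rigidBetween {p q k : ℤ} {m : ℕ} {x : G} (hx : RigidBetween M Δ p q x)
    (h₁ : p * m ≤ k) (h₂ : k ≤ q * m) (N : ℕ) :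
    (cyc M Δ m k)^[N] x = conjBy x (meet M (x ^ (m * N)) ((Δ : G) ^ (k * N))) := by
  induction N with
  | zero => simp [conjBy, hG.meet_eq_left (prec_refl (M := M) (1 : G))]
  | succ N ih =>
    rw [Function.iterate_succ_apply', ih, cyc, conjBy_conjBy, hG.mul_meet_conjBy]
    congr 1
    rw [hG.mul_meet, hG.meet_mul_zpow, zpow_natCast, ← pow_add, ← zpow_add]
    have he : x ^ (m + m * N) = x ^ (m * (N + 1)) := by congr 1; ring
    have hd : (Δ : G) ^ (k * N + k) = (Δ : G) ^ (k * (N + 1 : ℕ)) := by congr 1; push_cast; ring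
    rw [he, hd]
    refine (hG.meet_eq_of ((hG.meet_prec_left _ _).trans (hG.meet_prec_left _ _))
      ((hG.meet_prec_right _ _).trans (hG.meet_prec_right _ _)) fun g hg₁ hg₂ => ?_).symm
    have hN : (0 : ℤ) ≤ N := by positivity
    refine hG.prec_meet (hG.prec_meet hg₁ ?_) (hG.prec_meet ?_ hg₂)
    · have hle : (N : ℤ) * (p * m - k) ≤ 0 :=
        mul_nonpos_of_nonneg_of_nonpos hN (by linarith)
      have h3 := hG.prec_pow_mul_zpow hx m (m * N) (g := g * (Δ : G) ^ ((N : ℤ) * (p * m - k)))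
        ((mul_zpow_prec hle g).trans (he ▸ hg₁))
        (by
          rw [hG.mul_zpow_prec_iff, ← zpow_add]
          refine hg₂.trans (zpow_prec_zpow ?_)
          push_cast
          linarith)
      rw [hG.mul_zpow_prec_iff, mul_assoc, ← zpow_add] at h3
      convert h3 using 3
      push_cast; ring
    · have h3 := hG.prec_pow_mul_zpow hx (m * N) m (g := g * (Δ : G) ^ (p * m - k))
        ((mul_zpow_prec (by linarith) g).trans (by convert hg₁ using 2; ring))
        (by
          rw [hG.mul_zpow_prec_iff, ← zpow_add]
          refine hg₂.trans (zpow_prec_zpow ?_)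
          push_cast
          nlinarith)
      rw [hG.mul_zpow_prec_iff, mul_assoc, ← zpow_add] at h3
      convert h3 using 3
      ring

theorem mem_recurrenceSet_natCast {p q : ℤ} {x : G} (hx : RigidBetween M Δ p q x) (m : ℕ) (k : ℤ) :
    x ∈ recurrenceSet M Δ m k := by
  obtain ⟨e, he, hc⟩ := hG.exists_central
  rcases le_or_gt k (p * m) with h₁ | h₁
  · refine ⟨e, he, ?_⟩
    rw [hG.iterate_cyc_of_le, conjBy_eq_self]
    · rw [mul_comm, zpow_mul]
      exact (hc x).zpow_right k
    · rw [zpow_natCast]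
      exact (zpow_prec_zpow h₁).trans (hG.zpow_prec_pow hx.lo m)
  rcases le_or_gt (q * m) k with h₂ | h₂
  · refine ⟨1, one_pos, ?_⟩
    rw [Function.iterate_one, cyc, hG.meet_eq_left, conjBy_eq_self (Commute.self_zpow x _)]
    rw [zpow_natCast]
    exact (hG.pow_prec_zpow hx.hi m).trans (zpow_prec_zpow h₂)
  obtain ⟨j, hj⟩ := Int.eq_ofNat_of_zero_le (a := k - p * m) (by linarith)
  obtain ⟨i, hi⟩ := Int.eq_ofNat_of_zero_le (a := q * m - k) (by linarith)
  have hk : k = p * m + j := by linarith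
  have hji : ((j : ℤ) + i) = (q - p) * m := by linarith
  -- With N = e(j+i), kN splits as (mje)q + (mie)p, and the total conjugator is x^(mje) Δ^(miep),
  -- whose second factor is central.
  refine ⟨e * (j + i), Nat.mul_pos he (by omega), ?_⟩
  rw [hG.iterate_cyc_of_rigidBetween hx h₁.le h₂.le]
  have hpow : x ^ (m * (e * (j + i))) = x ^ (m * j * e + m * i * e) := by congr 1; ring
  have hexp : k * ((e * (j + i) : ℕ) : ℤ) =
      ((m * j * e : ℕ) : ℤ) * q + ((m * i * e : ℕ) : ℤ) * p := by
    push_cast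
    rw [hk]
    linear_combination (e : ℤ) * j * hji
  have hmeet : meet M (x ^ (m * (e * (j + i)))) ((Δ : G) ^ (k * ((e * (j + i) : ℕ) : ℤ))) =
      x ^ (m * j * e) * (Δ : G) ^ (((m * i * e : ℕ) : ℤ) * p) := by
    rw [hpow, hexp]
    refine hG.meet_eq_of ?_ ?_ fun g => hG.prec_pow_mul_zpow hx _ _
    · rw [pow_add, prec_mul_left_iff, mul_comm _ p]
      exact hG.zpow_prec_pow hx.lo _
    · rw [zpow_add, hG.prec_mul_zpow_iff, mul_comm _ q]
      exact hG.pow_prec_zpow hx.hi _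
  rw [hmeet]
  refine conjBy_eq_self ((Commute.self_pow x _).mul_right ?_)
  have : ((m * i * e : ℕ) : ℤ) * p = (e : ℤ) * (m * i * p) := by push_cast; ring
  rw [this, zpow_mul]
  exact (hc x).zpow_right _

omit hG in
theorem iterate_cyc_inv (m k : ℤ) (x : G) (N : ℕ) :
    (cyc M Δ m k)^[N] x = ((cyc M Δ (-m) k)^[N] x⁻¹)⁻¹ := by
  induction N with
  | zero => simp
  | succ N ih =>
    rw [Function.iterate_succ_apply', Function.iterate_succ_apply', ih, cyc, cyc, conjBy_inv,
      inv_zpow']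

/-- Negative m reduces to positive m, since inversion preserves rigidity and exchanges the cyclings
of orders (m,k) and (-m,k). -/
theorem mem_recurrenceSet {p q : ℤ} {x : G} (hx : RigidBetween M Δ p q x) (m k : ℤ) :
    x ∈ recurrenceSet M Δ m k := by
  obtain ⟨n, rfl | rfl⟩ := m.eq_nat_or_neg
  · exact hG.mem_recurrenceSet_natCast hx n k
  · obtain ⟨N, hN, h⟩ := hG.mem_recurrenceSet_natCast (hG.rigidBetween_inv hx) n k
    refine ⟨N, hN, ?_⟩
    rw [iterate_cyc_inv, neg_neg, h, inv_inv]

/-- The conjugates of a rigid element lying in all the recurrence sets are its rigid conjugates. -/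
theorem stableSummitSet_eq {x : G} (hx : IsRigid M Δ x) :
    stableSummitSet M Δ x = {y : G | IsConj x y ∧ IsRigid M Δ y} := by
  obtain ⟨p, q, hx⟩ := hG.isRigid_iff.1 hx
  ext y
  simp only [stableSummitSet, conjClass, Set.mem_inter_iff, Set.mem_ofPred_eq, Set.mem_iInter]
  refine and_congr_right fun hconj => ⟨fun h => ?_, fun h m k => ?_⟩
  · obtain ⟨u, rfl⟩ := isConj_iff_exists_conjBy.1 hconj
    exact hG.isRigid_iff.2
      ⟨p, q, hG.rigidBetween_of_recurrent hx (h 1 p) (h 1 q) (h 2 (p + q))⟩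
  · obtain ⟨p, q, hy⟩ := hG.isRigid_iff.1 h
    exact hG.mem_recurrenceSet hy m k

end IsGarsideGroup

end Summit

/-! ### Denominators of translation numbers and rigid powers -/

section Roots

variable {G : Type*} [Group G] {M : Submonoid G} {Δ : M}

namespace IsGarsideGroup

variable (hG : IsGarsideGroup M Δ)
include hG

/-- The meet of `1, f 1, …, f ^ n 1`, where `f u = y ^ k u Δ ^ (-s)`, for a property `C` stable
under meets. -/
theorem exists_meet_orbit {C : G → Prop} (hC : MeetStable M Δ C) {y : G} (hy : C y) (k s : ℤ)
    (n : ℕ) : ∃ u, C (conjBy y u) ∧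
      (∀ i : ℕ, i ≤ n → Prec M u (y ^ (k * i) * (Δ : G) ^ (-(s * i)))) ∧
      ∀ g, (∀ i : ℕ, i ≤ n → Prec M g (y ^ (k * i) * (Δ : G) ^ (-(s * i)))) → Prec M g u := by
  induction n with
  | zero =>
    refine ⟨1, by rwa [conjBy_one], fun i hi => ?_, fun g hg => by simpa using hg 0 le_rfl⟩
    obtain rfl : i = 0 := by omega
    simpa using prec_refl _
  | succ n ih =>
    obtain ⟨u, h1, h2, h3⟩ := ih
    have hC' : C (conjBy y (y ^ (k * (n + 1 : ℕ)) * (Δ : G) ^ (-(s * (n + 1 : ℕ))))) := by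
      rw [← conjBy_conjBy, conjBy_eq_self (Commute.self_zpow y _)]
      exact hC.twist _ _ hy
    refine ⟨_, hC.meet y _ _ h1 hC', fun i hi => ?_, fun g hg => ?_⟩
    · rcases Nat.lt_or_ge n i with h | h
      · obtain rfl : i = n + 1 := by omega
        exact hG.meet_prec_right _ _
      · exact (hG.meet_prec_left _ _).trans (h2 i h)
    · exact hG.prec_meet (h3 g fun i hi => hg i (by omega)) (hg _ le_rfl)

/-- If `Δ ^ (s n) ≺ y ^ (k n)`, then some conjugate `z` of `y` satisfies `Δ ^ s ≺ z ^ k`. -/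
theorem exists_conjBy_zpow_prec {C : G → Prop} (hC : MeetStable M Δ C) {y : G} (hy : C y)
    {k s : ℤ} {n : ℕ} (hn : 0 < n) (h : Prec M ((Δ : G) ^ (s * n)) (y ^ (k * n))) :
    ∃ u, C (conjBy y u) ∧ Prec M ((Δ : G) ^ s) (conjBy y u ^ k) := by
  obtain ⟨n, rfl⟩ : ∃ n', n = n' + 1 := ⟨n - 1, by omega⟩
  obtain ⟨u, h1, h2, h3⟩ := hG.exists_meet_orbit hC hy k s n
  refine ⟨u, h1, ?_⟩
  -- The map f sends the orbit points 1, …, fⁿ(1) to f(1), …, fⁿ⁺¹(1), and the hypothesis says 1 ≺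
  -- fⁿ⁺¹(1); hence u ≺ f(u).
  rw [conjBy_zpow, zpow_prec_conjBy_iff, ← inv_mul_prec_iff]
  refine h3 _ fun i hi => ?_
  have h4 : Prec M u (y ^ (k * (i + 1 : ℕ)) * (Δ : G) ^ (-(s * (i + 1 : ℕ)))) := by
    rcases Nat.lt_or_ge i n with hlt | hge
    · exact h2 (i + 1) hlt
    · obtain rfl : i = n := by omega
      have h5 := h2 0 (by omega)
      simp only [CharP.cast_eq_zero, mul_zero, zpow_zero, neg_zero, mul_one] at h5
      refine h5.trans ?_
      rw [← hG.mul_zpow_prec_iff, one_mul]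
      exact h
  rw [inv_mul_prec_iff, ← mul_assoc, ← zpow_add, hG.mul_zpow_prec_iff, mul_assoc, ← zpow_add]
  convert h4 using 3 <;> push_cast <;> ring

/-- A strict chain from `1` to `Δ` has length at most `‖Δ‖`. -/
theorem le_factorNorm_of_chain {g : ℕ → G} {n : ℕ} (h0 : g 0 = 1)
    (hg : ∀ i < n, Prec M (g i) (g (i + 1)) ∧ g i ≠ g (i + 1)) : n ≤ factorNorm M (g n) := by
  have : ∀ i ≤ n, g i ∈ M ∧ i ≤ factorNorm M (g i) := by
    intro i
    induction i with
    | zero => exact fun _ => ⟨by rw [h0]; exact M.one_mem, Nat.zero_le _⟩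
    | succ i ih =>
      intro hi
      obtain ⟨h1, h2⟩ := ih (by omega)
      obtain ⟨h3, h4⟩ := hg i (by omega)
      have h5 : (g i)⁻¹ * g (i + 1) ∈ M := h3
      have h6 := hG.factorNorm_add_le h1 h5
      have h7 := hG.factorNorm_pos h5 (fun h => h4 (inv_mul_eq_one.1 h))
      have h8 := M.mul_mem h1 h5
      rw [mul_inv_cancel_left] at h6 h8
      exact ⟨h8, by omega⟩
  exact (this n le_rfl).2

/-- The meets of y^(ji) Δ^(-ci) with Δ increase from 1 at i = 0 to Δ at i = b. Each determines the
next, so a repetition before b would make the chain stop short of Δ. -/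
theorem le_factorNorm_of_zpow_prec {y : G} {j c : ℤ} {b : ℕ} (hpos : Prec M ((Δ : G) ^ c) (y ^ j))
    (htop : Prec M ((Δ : G) ^ (c * b + 1)) (y ^ (j * b)))
    (hnot : ∀ i : ℕ, i < b → ¬ Prec M ((Δ : G) ^ (c * i + 1)) (y ^ (j * i))) :
    b ≤ factorNorm M (Δ : G) := by
  set v : ℕ → G := fun i => y ^ (j * i) * (Δ : G) ^ (-(c * i)) with hv
  set h : ℕ → G := fun i => meet M (v i) (Δ : G) with hh
  have hvsucc : ∀ i, v (i + 1) = y ^ j * v i * (Δ : G) ^ (-c) := by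
    intro i
    simp only [hv]
    rw [← mul_assoc, ← zpow_add, mul_assoc, ← zpow_add]
    congr 2 <;> push_cast <;> ring
  have hΔ : ∀ i, Prec M (Δ : G) (v i) ↔ Prec M ((Δ : G) ^ (c * i + 1)) (y ^ (j * i)) := by
    intro i
    simp only [hv]
    rw [← hG.mul_zpow_prec_iff, ← zpow_one_add, add_comm]
  have hΔstep : Prec M (Δ : G) (y ^ j * (Δ : G) * (Δ : G) ^ (-c)) := by
    rw [← hG.mul_zpow_prec_iff, ← zpow_one_add, add_comm, zpow_add_one]
    have := (hG.prec_mul_zpow_iff 1).2 hpos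
    rwa [zpow_one] at this
  have hrec : ∀ i, h (i + 1) = meet M (y ^ j * h i * (Δ : G) ^ (-c)) (Δ : G) := by
    intro i
    simp only [hh]
    rw [hvsucc, hG.mul_meet, hG.meet_mul_zpow]
    refine hG.meet_eq_of ?_ (hG.meet_prec_right _ _) fun g h₁ h₂ =>
      hG.prec_meet (hG.prec_meet h₁ (h₂.trans hΔstep)) h₂
    exact (hG.meet_prec_left _ _).trans (hG.meet_prec_left _ _)
  have h0 : h 0 = 1 := by
    simp only [hh, hv]
    simpa using hG.meet_eq_left (one_prec_iff.2 Δ.2)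
  have hb : h b = Δ := hG.meet_eq_right ((hΔ b).2 htop)
  have hmono : ∀ i, Prec M (h i) (h (i + 1)) := by
    intro i
    refine hG.prec_meet ((hG.meet_prec_left _ _).trans ?_) (hG.meet_prec_right _ _)
    have h1 : v (i + 1) = v i * (conjBy (y ^ j * (Δ : G) ^ (-c)) ((Δ : G) ^ (-(c * i)))) := by
      simp only [hv, conjBy]
      rw [show j * ((i + 1 : ℕ) : ℤ) = j * i + j by push_cast; ring,
        show -(c * ((i + 1 : ℕ) : ℤ)) = -c + -(c * i) by push_cast; ring, zpow_add, zpow_add]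
      group
    rw [h1]
    refine prec_mul_right (hG.conjBy_zpow_mem _ ?_)
    rwa [← one_prec_iff, ← hG.mul_zpow_prec_iff, one_mul]
  rw [← hb]
  refine hG.le_factorNorm_of_chain h0 fun i hi => ⟨hmono i, fun heq => hnot i hi ?_⟩
  have hconst : ∀ t, h (i + t) = h i := by
    intro t
    induction t with
    | zero => rfl
    | succ t ih => rw [← add_assoc, hrec, ih, ← hrec, ← heq]
  have := hconst (b - i)
  rw [Nat.add_sub_cancel' hi.le, hb] at this
  rw [← hΔ, this]
  exact hG.meet_prec_left _ _

/-- If `y ^ m` is rigid and its normal form starts with `Δ ^ p`, then the denominator of the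
translation number `p / m` is at most `‖Δ‖`. -/
theorem exists_dvd_mul_of_rigidBetween {p q : ℤ} {m : ℕ} (hm : 0 < m) {y : G}
    (hy : RigidBetween M Δ p q (y ^ (m : ℤ))) :
    ∃ b : ℕ, 0 < b ∧ b ≤ factorNorm M (Δ : G) ∧ (m : ℤ) ∣ b * p := by
  obtain ⟨d, a, b, hd, hcop, hp, hmb⟩ : ∃ (d : ℕ) (a b : ℤ), 0 < d ∧ IsCoprime a b ∧
      p = a * d ∧ (m : ℤ) = b * d := by
    have hd : 0 < Int.gcd p m := Int.gcd_pos_of_ne_zero_right _ (by omega)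
    refine ⟨Int.gcd p m, p / Int.gcd p m, m / Int.gcd p m, hd, ?_, ?_, ?_⟩
    · rw [Int.isCoprime_iff_gcd_eq_one]
      exact Int.gcd_div_gcd_div_gcd hd
    · exact (Int.ediv_mul_cancel (Int.gcd_dvd_left ..)).symm
    · exact (Int.ediv_mul_cancel (Int.gcd_dvd_right ..)).symm
  have hb : 0 < b := by
    by_contra h
    have : (0 : ℤ) < m := by exact_mod_cast hm
    nlinarith
  lift b to ℕ using hb.le
  have hmb' : m = b * d := by exact_mod_cast hmb
  -- Inverting a modulo b gives y^j the translation number c + 1/b; adding the multiple b|u| makes j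
  -- nonnegative.
  obtain ⟨j, c, hj⟩ : ∃ (j : ℕ) (c : ℤ), j * a = 1 + c * b := by
    obtain ⟨u, v, huv⟩ := hcop
    obtain ⟨j, hj⟩ := Int.eq_ofNat_of_zero_le (a := u + b * |u|) (by
      have := neg_abs_le u
      have := abs_nonneg u
      nlinarith)
    refine ⟨j, a * |u| - v, ?_⟩
    rw [← hj]
    linear_combination huv
  refine ⟨b, by exact_mod_cast hb, ?_, ⟨a, by rw [hp, hmb]; ring⟩⟩
  have hd' : (1 : ℤ) ≤ d := by exact_mod_cast hd
  have hpow : ∀ (z : G) (n : ℕ), RigidBetween M Δ p q (z ^ (m : ℤ)) →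
      Prec M ((Δ : G) ^ (p * n)) (z ^ ((m : ℤ) * n)) := by
    intro z n hz
    rw [zpow_mul z, zpow_natCast _ n]
    exact hG.zpow_prec_pow hz.lo n
  have hC := hG.meetStable_rigidBetween p q m
  obtain ⟨u, hu, hu'⟩ := hG.exists_conjBy_zpow_prec hC hy (k := j) (s := c) hm (by
    rw [mul_comm (j : ℤ)]
    refine (zpow_prec_zpow ?_).trans (hpow y j hy)
    rw [hp, hmb]
    have : (a : ℤ) * d * j = d + c * (b * d) := by linear_combination (d : ℤ) * hj
    linarith)
  have hC' := hC.and (hG.meetStable_lo j c)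
  obtain ⟨w, ⟨hw, hw'⟩, hw''⟩ := hG.exists_conjBy_zpow_prec hC' ⟨hu, hu'⟩
    (k := j * b) (s := c * b + 1) hd (by
    have h1 := hpow _ j hu
    have e1 : (j : ℤ) * b * d = m * j := by rw [hmb]; ring
    have e2 : (c * b + 1) * d = p * j := by rw [hp]; linear_combination -(d : ℤ) * hj
    rwa [e1, e2])
  refine hG.le_factorNorm_of_zpow_prec hw' hw'' fun i hi h => ?_
  set z := conjBy (conjBy y u) w
  -- For i < b the m-th power of the relation would give (z^m)^(ji) the lower bound Δ^((ci+1)m),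
  -- whose exponent exceeds pji = cim + di because d(i+1) ≤ bd = m.
  refine hG.not_zpow_succ_prec_pow hw (j * i) ?_
  have h1 := hG.zpow_prec_pow h m
  rw [← zpow_natCast, ← zpow_mul] at h1 ⊢
  have e1 : (j : ℤ) * i * m = m * ((j * i : ℕ) : ℤ) := by push_cast; ring
  rw [e1] at h1
  refine (zpow_prec_zpow ?_).trans h1
  push_cast
  have e2 : p * ((j : ℤ) * i) = c * i * m + d * i := by
    rw [hp, hmb]; linear_combination (d : ℤ) * i * hj
  rw [e2, add_mul, hmb]
  have : (i : ℤ) + 1 ≤ b := by exact_mod_cast hi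
  nlinarith

/-- A g violating rigidity of w yields gΔ^(p(m-1)), which violates rigidity of w^m. -/
theorem rigidBetween_of_pow {p q : ℤ} {m : ℕ} (hm : 0 < m) {w : G}
    (hw : RigidBetween M Δ (p * m) (q * m) (w ^ m)) (hlo : Prec M ((Δ : G) ^ p) w)
    (hhi : Prec M w ((Δ : G) ^ q)) : RigidBetween M Δ p q w where
  lt := lt_of_mul_lt_mul_right hw.lt (by positivity)
  lo := hlo
  hi := hhi
  ne_lo h := hw.ne_lo (by rw [h, ← zpow_natCast, ← zpow_mul])
  ne_hi h := hw.ne_hi (by rw [h, ← zpow_natCast, ← zpow_mul])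
  rigid := by
    intro g h₁ h₂
    obtain ⟨n, rfl⟩ : ∃ n, m = n + 1 := ⟨m - 1, by omega⟩
    have h3 := hw.rigid (g * (Δ : G) ^ (p * n)) ?_ ?_
    · rw [hG.mul_zpow_prec_iff, ← zpow_add] at h3
      convert h3 using 2
      push_cast; ring
    · rw [pow_succ']
      exact ((hG.prec_mul_zpow_iff _).2 h₁).trans
        ((prec_mul_left_iff w).2 (hG.zpow_prec_pow hlo n))
    · have h4 := (prec_mul_left_iff (w ^ n)).2 h₂
      rw [← mul_assoc, ← pow_succ] at h4
      have h5 := (hG.prec_mul_zpow_iff (p * n)).2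
        (h4.trans ((hG.prec_mul_zpow_iff (p + q)).2 (hG.pow_prec_zpow hhi n)))
      rw [← zpow_add, ← zpow_add] at h5
      rw [← mul_assoc]
      convert h5 using 2
      push_cast; ring

theorem rigidBetween_pow {p q : ℤ} {x : G} (hx : RigidBetween M Δ p q x) {n : ℕ} (hn : 0 < n) :
    RigidBetween M Δ (p * n) (q * n) (x ^ n) := by
  refine ⟨mul_lt_mul_of_pos_right hx.lt (by exact_mod_cast hn), hG.zpow_prec_pow hx.lo n,
    hG.pow_prec_zpow hx.hi n, fun g h₁ h₂ => ?_, fun h => hx.ne_lo ?_, fun h => hx.ne_hi ?_⟩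
  · have h3 := hG.prec_pow_mul_zpow hx n n (g := x ^ n * g)
      (by rwa [pow_add, prec_mul_left_iff])
      (by convert h₂ using 2; ring)
    rwa [prec_mul_left_iff, mul_comm] at h3
  all_goals obtain ⟨n, rfl⟩ : ∃ n', n = n' + 1 := ⟨n - 1, by omega⟩
  · refine hG.antisymm ?_ hx.lo
    have h1 := (prec_mul_left_iff x).2 (hG.zpow_prec_pow hx.lo n)
    rw [← pow_succ', h, hG.mul_zpow_prec_iff, ← zpow_add] at h1
    convert h1 using 2
    push_cast; ring
  · refine hG.antisymm hx.hi ?_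
    have h1 := (prec_mul_left_iff x).2 (hG.pow_prec_zpow hx.hi n)
    rw [← pow_succ', h, hG.prec_mul_zpow_iff_mul_neg, ← zpow_add] at h1
    convert h1 using 2
    push_cast; ring

theorem zpow_neg_prec_inv_iff {s : ℤ} {x : G} :
    Prec M ((Δ : G) ^ (-s)) x⁻¹ ↔ Prec M x ((Δ : G) ^ s) := by
  rw [← mul_one x⁻¹, prec_inv_mul_iff, hG.mul_zpow_prec_iff, neg_neg, one_mul]

theorem two_le_factorNorm {p q : ℤ} {x : G} (hx : RigidBetween M Δ p q x) :
    2 ≤ factorNorm M (Δ : G) := by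
  have h1 := hG.letter_mem_simples p x 0
  have h2 : letter M Δ p x 0 ≠ 1 := hG.letter_ne_one fun h =>
    hx.ne_lo (hG.antisymm (by simpa using h) hx.lo)
  have h3 := hG.letter_ne_delta hx.lo (hG.not_zpow_succ_prec hx) 0
  have h4 := hG.factorNorm_add_le h1.1 h1.2
  rw [mul_inv_cancel_left] at h4
  have h5 := hG.factorNorm_pos h1.1 h2
  have h6 := hG.factorNorm_pos h1.2 (fun h => h3 (inv_mul_eq_one.1 h))
  omega

theorem exists_rigidBetween_pow {p q : ℤ} {m : ℕ} (hm : 0 < m) {y : G}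
    (hy : RigidBetween M Δ p q (y ^ (m : ℤ))) :
    ∃ N : ℕ, 0 < N ∧ N < factorNorm M (Δ : G) ^ 2 ∧
      ∃ u p' q', RigidBetween M Δ p' q' (conjBy y u ^ N) := by
  obtain ⟨b, hb0, hb, hbp⟩ := hG.exists_dvd_mul_of_rigidBetween hm hy
  have hyinv : RigidBetween M Δ (-q) (-p) (y⁻¹ ^ (m : ℤ)) := by
    rw [inv_zpow]; exact hG.rigidBetween_inv hy
  obtain ⟨b', hb0', hb', hbq⟩ := hG.exists_dvd_mul_of_rigidBetween hm hyinv
  rw [mul_neg, dvd_neg] at hbq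
  have h2 := hG.two_le_factorNorm hy
  obtain ⟨N, hN0, hN, hNp, hNq⟩ : ∃ N : ℕ, 0 < N ∧ N < factorNorm M (Δ : G) ^ 2 ∧
      (m : ℤ) ∣ N * p ∧ (m : ℤ) ∣ N * q := by
    -- Equal denominators give N = b ≤ ‖Δ‖ < ‖Δ‖², as ‖Δ‖ ≥ 2; for distinct ones, the smaller is
    -- below ‖Δ‖, so bb' < ‖Δ‖².
    by_cases heq : b = b'
    · subst heq
      exact ⟨b, hb0, by nlinarith, hbp, hbq⟩
    · refine ⟨b * b', Nat.mul_pos hb0 hb0', ?_, ?_, ?_⟩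
      · rcases Nat.lt_or_gt_of_ne heq with h | h <;> nlinarith
      · have : ((b * b' : ℕ) : ℤ) * p = b' * (b * p) := by push_cast; ring
        rw [this]; exact hbp.mul_left _
      · have : ((b * b' : ℕ) : ℤ) * q = b * (b' * q) := by push_cast; ring
        rw [this]; exact hbq.mul_left _
  obtain ⟨p', hp'⟩ := hNp
  obtain ⟨q', hq'⟩ := hNq
  refine ⟨N, hN0, hN, ?_⟩
  have hC := hG.meetStable_rigidBetween p q m
  obtain ⟨u, hu, hu'⟩ := hG.exists_conjBy_zpow_prec hC hy (k := N) (s := p') hm (by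
    rw [mul_comm (N : ℤ), zpow_mul y, zpow_natCast _ N, mul_comm p', ← hp', mul_comm]
    exact hG.zpow_prec_pow hy.lo N)
  -- The upper bound is a lower bound for the inverse power; including the lower bound already
  -- obtained in the stable property keeps it.
  obtain ⟨w, ⟨hw, hwlo⟩, hwhi⟩ := hG.exists_conjBy_zpow_prec (hC.and (hG.meetStable_lo N p'))
    ⟨hu, hu'⟩ (k := -N) (s := -q') hm (by
    rw [neg_mul, neg_mul, zpow_neg _ ((N : ℤ) * m), hG.zpow_neg_prec_inv_iff,
      mul_comm (N : ℤ), zpow_mul (conjBy y u), zpow_natCast _ N, mul_comm q', ← hq', mul_comm]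
    exact hG.pow_prec_zpow hu.hi N)
  rw [conjBy_conjBy] at hw hwlo hwhi
  refine ⟨u * w, p', q', hG.rigidBetween_of_pow hm ?_ (by rwa [zpow_natCast] at hwlo) ?_⟩
  · have := hG.rigidBetween_pow hw hN0
    rw [mul_comm p, mul_comm q, hp', hq', zpow_natCast, ← pow_mul, mul_comm m N, pow_mul] at this
    rwa [mul_comm p', mul_comm q']
  · rwa [zpow_neg _ (N : ℤ), hG.zpow_neg_prec_inv_iff, zpow_natCast] at hwhi

/-- If some power of `x` is conjugate to a rigid element, then so is a power whose exponent is
positive and less than `‖Δ‖ ^ 2`. -/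
theorem exists_isRigid_pow {x r : G} {m : ℤ} (hr : IsRigid M Δ r) (hconj : IsConj (x ^ m) r) :
    ∃ N : ℕ, 0 < N ∧ N < atomNorm Δ ^ 2 ∧ ∃ r : G, IsRigid M Δ r ∧ IsConj (x ^ N) r := by
  obtain ⟨p, q, hr⟩ := hG.isRigid_iff.1 hr
  obtain ⟨u, rfl⟩ := isConj_iff_exists_conjBy.1 hconj
  rw [← conjBy_zpow] at hr
  have hnat : ∃ (n : ℕ) (p q : ℤ), RigidBetween M Δ p q (conjBy x u ^ (n : ℤ)) := by
    obtain ⟨n, rfl | rfl⟩ := m.eq_nat_or_neg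
    · exact ⟨n, p, q, hr⟩
    · have := hG.rigidBetween_inv hr
      rw [← zpow_neg, neg_neg] at this
      exact ⟨n, _, _, this⟩
  obtain ⟨n, p, q, hn⟩ := hnat
  have hn0 : 0 < n := by
    rcases Nat.eq_zero_or_pos n with rfl | h
    · exact (hG.rigidBetween_one_false (by simpa using hn)).elim
    · exact h
  obtain ⟨N, hN0, hN, w, p', q', hw⟩ := hG.exists_rigidBetween_pow hn0 hn
  refine ⟨N, hN0, hN.trans_le (Nat.pow_le_pow_left (hG.factorNorm_le_atomNorm Δ) 2), _,
    hG.isRigid_iff.2 ⟨p', q', hw⟩, isConj_iff_exists_conjBy.2 ⟨u * w, ?_⟩⟩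
  rw [conjBy_conjBy, conjBy_pow]

end IsGarsideGroup

end Roots

end Garside

theorem theorem7p5 {G : Type*} [Group G] (M : Submonoid G) (Δ : M)
    (hG : Garside.IsGarsideGroup M Δ) :
    (∀ x : G, Garside.IsRigid M Δ x →
      Garside.stableSummitSet M Δ x = {y : G | IsConj x y ∧ Garside.IsRigid M Δ y}) ∧
    (∀ x : G, (∃ m : ℤ, ∃ r : G, Garside.IsRigid M Δ r ∧ IsConj (x ^ m) r) →
      ∃ N : ℕ, 0 < N ∧ N < Garside.atomNorm Δ ^ 2 ∧
        ∃ r : G, Garside.IsRigid M Δ r ∧ IsConj (x ^ N) r) :=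
  ⟨fun _ hx => hG.stableSummitSet_eq hx, fun _ ⟨_, _, hr, h⟩ => hG.exists_isRigid_pow hr h⟩
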